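/- Consider a sequence of problems indexed by $t\in\mathbb N$; all quantities below may depend on $t$ (the index is suppressed), except $k,\sigma_x,c_{\min},c_{\max},\nu$ and the constants named $c_\lambda,C_\lambda,c_\mu,C_\mu,\kappa$. Let $\mathcal G$ be a simple undirected graph on $\{1,\dots,n\}$ with maximum degree $d\ge 2$, where $n\to\infty$. Let $F$ be its oriented incidence matrix (the row of an edge $\{i,j\}$, $i<j$, has $-1$ at $i$, $+1$ at $j$ and $0$ elsewhere), and for an integer $k\ge 0$ let $\Delta^{(k+1)}$ be the graph difference operator of order $k+1$: $\Delta^{(1)}=F$, $\Delta^{(k+1)}=F^T\Delta^{(k)}$ for odd $k$ and $\Delta^{(k+1)}=F\Delta^{(k)}$ for even $k\ge2$. Let $y=X\beta^*+\varepsilon$ with $X\in\mathbb R^{N\times n}$, $N\ge 1$, where - $\beta^*\in\mathbb R^n$ is deterministic, $\|\Delta^{(k+1)}\beta^*\|_0\le s_1$, $\|\beta^*\|_0\le s_2$, with integers $s_1,s_2\ge1$ and $s_2/s_1\ge\nu$ for a constant $0\le\nu<1$; - the rows of $X$ are i.i.d. $\sigma_x$-sub-Gaussian (mean zero, and $\mathbb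 E e^{\tau u^TX_i}\le e^{\sigma_x^2\tau^2/2}$ for all unit vectors $u$ and real $\tau$), with covariance matrix $\Sigma_x$ whose eigenvalues lie in $[c_{\min},c_{\max}]$, $c_{\min}>0$; put $\Theta_x=\Sigma_x^{-1}$ and let $M_n$ bound its largest absolute row sum; - $\varepsilon\sim N(0,\sigma_\varepsilon^2I_N)$, $\sigma_\varepsilon>0$, is independent of $X$. Write $\Sigma_N=X^TX/N$, and let $\|\cdot\|_\infty$ be the largest absolute value of an entry of a vector or matrix. Let $\hat\beta$ be any minimizer of $\frac1{2N}\|y-X\beta\|_2^2+\lambda_g\|\Delta^{(k+1)}\beta\|_1+\lambda\|\beta\|_1$ over $\beta\in\mathbb R^n$. Let $\widehat\Theta$ be a measurable function of $X$ that minimizes $\sum_{i,j}|\Theta_{ij}|$ over the $\Theta\in\mathbb R^{n\times n}$ with $\|\Theta\Sigma_N-I_n\|_\infty\le\mu$ whenever such $\Theta$ exist. Put $\tilde\beta=\hat\beta+\frac1N\widehat\Theta X^T(y-X\hat\beta)$. There are constants $c_\lambda,c_\mu,\kappa>0$ depending only on $\sigma_x,c_{\min},c_{\max},\nu$ such that the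 following holds whenever, for some constants $C_\lambda,C_\mu$, $$c_\lambda\sigma_\varepsilon\sqrt{\tfrac{\log n}{N}}\le\lambda\le C_\lambda\sigma_\varepsilon\sqrt{\tfrac{\log n}{N}},\qquad \lambda_g=\lambda\sqrt{\tfrac{\nu}{(2d)^{k+1}}},\qquad c_\mu\sqrt{\tfrac{\log n}{N}}\le\mu\le C_\mu\sqrt{\tfrac{\log n}{N}} .$$ 1. $\sqrt N(\Delta^{(k+1)}\tilde\beta-\Delta^{(k+1)}\beta^*)=\Psi^{(k+1)}-e^{(k+1)}$, where $\Psi^{(k+1)}=\frac1{\sqrt N}\Delta^{(k+1)}\widehat\Theta X^T\varepsilon$ and $e^{(k+1)}=\sqrt N\,\Delta^{(k+1)}(\widehat\Theta\Sigma_N-I_n)(\hat\beta-\beta^*)$. 2. The conditional law of $\Psi^{(k+1)}$ given $X$ is $N\big(0,\ \sigma_\varepsilon^2\,\Delta^{(k+1)}\widehat\Theta\Sigma_N\widehat\Theta^T(\Delta^{(k+1)})^T\big)$. 3. If $N\ge\kappa\, s_2\log n$ for all large $t$, then $\|e^{(k+1)}\|_\infty=\mathcal O_{\mathbb P}\Big(\sigma_\varepsilon(2d)^{\frac{k+1}2}\frac{s_2\log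 n}{\sqrt N}\Big)$. 4. $\big\|\Delta^{(k+1)}\widehat\Theta\Sigma_N\widehat\Theta^T(\Delta^{(k+1)})^T-\Delta^{(k+1)}\Theta_x(\Delta^{(k+1)})^T\big\|_\infty=\mathcal O_{\mathbb P}\Big((2d)^{k+1}M_n\sqrt{\tfrac{\log n}{N}}\Big)$. Here $Y_t=\mathcal O_{\mathbb P}(a_t)$ means that for each $\delta>0$ there is $K>0$ with $\mathbb P(|Y_t|>Ka_t)\le\delta$ for all large $t$. -/

import Mathlib

open MeasureTheory ProbabilityTheory Filter Matrix

namespace GPPL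

noncomputable section

/-! ### Matrices and norms -/

/-- The (product) Borel σ-algebra on real matrices. -/
instance instMeasurableSpaceMatrix {m n : Type*} : MeasurableSpace (Matrix m n ℝ) :=
  inferInstanceAs (MeasurableSpace (m → n → ℝ))

/-- The number of nonzero entries of a vector, `‖v‖₀`. -/
def l0 {ι : Type*} (v : ι → ℝ) : ℕ := {i | v i ≠ 0}.ncard

/-- The `ℓ₁`-norm of a vector. -/
def l1 {ι : Type*} [Fintype ι] (v : ι → ℝ) : ℝ := ∑ i, |v i|

/-- The largest absolute value of an entry of a vector (`0` for the empty vector). -/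
def vecMax {ι : Type*} (v : ι → ℝ) : ℝ := ⨆ i, |v i|

/-- The element-wise `ℓ₁`-norm `‖M‖_{1,1}` of a matrix. -/
def l11 {m n : Type*} [Fintype m] [Fintype n] (M : Matrix m n ℝ) : ℝ := ∑ i, ∑ j, |M i j|

/-- The element-wise infinity norm of a matrix: the largest absolute value of an entry. -/
def matMax {m n : Type*} (M : Matrix m n ℝ) : ℝ := ⨆ i, ⨆ j, |M i j|

/-- The `ℓ_∞`-operator norm of a matrix: the largest absolute row sum. -/
def opInf {m n : Type*} [Fintype n] (M : Matrix m n ℝ) : ℝ := ⨆ i, ∑ j, |M i j|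

/-! ### Graph difference operators -/

section Graph

variable {n : ℕ} (G : SimpleGraph (Fin n))

/-- The oriented incidence matrix `F`, with rows indexed by the edges: the row of an edge `{i, j}`
with `i < j` has the entry `-1` at `i`, the entry `+1` at `j`, and zeros elsewhere. -/
def incidence : Matrix G.edgeSet (Fin n) ℝ :=
  fun e v => if v = e.1.inf then -1 else if v = e.1.sup then 1 else 0

/-- The index type of the rows of the graph difference operator of order `k + 1`:
the edges for even `k`, the vertices for odd `k`. -/
def DiffRow : ℕ → Type
  | 0 => G.edgeSet
  | 1 => Fin n
  | k + 2 => DiffRow k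

instance instFintypeDiffRow [DecidableRel G.Adj] : ∀ k, Fintype (DiffRow G k)
  | 0 => inferInstanceAs (Fintype G.edgeSet)
  | 1 => inferInstanceAs (Fintype (Fin n))
  | k + 2 => instFintypeDiffRow k

instance instDecidableEqDiffRow : ∀ k, DecidableEq (DiffRow G k)
  | 0 => inferInstanceAs (DecidableEq G.edgeSet)
  | 1 => inferInstanceAs (DecidableEq (Fin n))
  | k + 2 => instDecidableEqDiffRow k

/-- The matrix by which the operator of order `k + 1` is multiplied on the left to give the
operator of order `k + 2`: it is `Fᵀ` for even `k` and `F` for odd `k`. -/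
def diffStep : ∀ k, Matrix (DiffRow G (k + 1)) (DiffRow G k) ℝ
  | 0 => (incidence G)ᵀ
  | 1 => incidence G
  | k + 2 => diffStep k

/-- The graph difference operator of order `k + 1`: `diffOp G k` is `Δ^{(k+1)}`, so that
`Δ^{(1)} = F`, `Δ^{(2)} = Fᵀ F`, `Δ^{(3)} = F Fᵀ F`, and so on. -/
def diffOp [DecidableRel G.Adj] : ∀ k, Matrix (DiffRow G k) (Fin n) ℝ
  | 0 => incidence G
  | k + 1 => diffStep G k * diffOp k

end Graph

/-! ### Sub-Gaussian variables and designs, stochastic boundedness -/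

/-- A real random variable is `σ`-sub-Gaussian if it has mean zero and its moment generating
function is finite and at most `exp (σ² t² / 2)` for all real `t`. -/
def IsSubGaussian {Ω : Type*} [MeasurableSpace Ω] (P : Measure Ω) (Z : Ω → ℝ) (σ : ℝ) : Prop :=
  ∫ ω, Z ω ∂P = 0 ∧ HasSubgaussianMGF Z (σ ^ 2).toNNReal P

/-- `X` is a row-wise `(σ, S)`-sub-Gaussian random matrix: its rows are i.i.d., centred, have
covariance matrix `S`, and every unit-norm linear combination of the entries of a row is
`σ`-sub-Gaussian. -/
structure IsSubGaussianDesign {Ω : Type*} [MeasurableSpace Ω] (P : Measure Ω) {N n : ℕ}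
    (X : Ω → Matrix (Fin N) (Fin n) ℝ) (σ : ℝ) (S : Matrix (Fin n) (Fin n) ℝ) : Prop where
  measurable : Measurable X
  indep : iIndepFun (fun (i : Fin N) (ω : Ω) => X ω i) P
  ident : ∀ i j, IdentDistrib (fun ω => X ω i) (fun ω => X ω j) P P
  mean : ∀ i a, ∫ ω, X ω i a ∂P = 0
  subGaussian : ∀ i (u : Fin n → ℝ), u ⬝ᵥ u = 1 → IsSubGaussian P (fun ω => u ⬝ᵥ X ω i) σ
  cov : ∀ i a b, covariance (fun ω => X ω i a) (fun ω => X ω i b) P = S a b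

/-- `Y_t = O_P(a_t)` as `t → ∞`: the ratios `Y_t / a_t` are stochastically bounded. -/
def IsBigOInProb {Ω : ℕ → Type*} [∀ t, MeasurableSpace (Ω t)] (P : ∀ t, Measure (Ω t))
    (Y : ∀ t, Ω t → ℝ) (a : ℕ → ℝ) : Prop :=
  ∀ δ : ℝ, 0 < δ → ∃ K : ℝ, 0 < K ∧
    ∀ᶠ t in atTop, P t {ω | K * a t < |Y t ω|} ≤ ENNReal.ofReal δ

/-! ### The estimators -/

section Estimators

variable {N n : ℕ}

/-- The sample second-moment matrix `Σ_N = Xᵀ X / N`. -/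
def sampleGram (X : Matrix (Fin N) (Fin n) ℝ) : Matrix (Fin n) (Fin n) ℝ :=
  (1 / (N : ℝ)) • (Xᵀ * X)

/-- The response `y = X β + ε` of the linear model. -/
def response (X : Matrix (Fin N) (Fin n) ℝ) (β : Fin n → ℝ) (ε : Fin N → ℝ) : Fin N → ℝ :=
  X *ᵥ β + ε

/-- The objective `‖y - X β‖₂² / (2 N) + lamG ‖Δ β‖₁ + lam ‖β‖₁`. -/
def objective {m : Type*} [Fintype m] (D : Matrix m (Fin n) ℝ) (lamG lam : ℝ)
    (X : Matrix (Fin N) (Fin n) ℝ) (y : Fin N → ℝ) (β : Fin n → ℝ) : ℝ :=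
  1 / (2 * (N : ℝ)) * ∑ i, (y i - (X *ᵥ β) i) ^ 2 + lamG * l1 (D *ᵥ β) + lam * l1 β

/-- `β` is a `k`-th order Graph-Piecewise-Polynomial-Lasso estimate: a minimizer of the
objective with `Δ = Δ^{(k+1)}`. -/
def IsGraphLasso (G : SimpleGraph (Fin n)) [DecidableRel G.Adj] (k : ℕ) (lamG lam : ℝ)
    (X : Matrix (Fin N) (Fin n) ℝ) (y : Fin N → ℝ) (β : Fin n → ℝ) : Prop :=
  ∀ b, objective (diffOp G k) lamG lam X y β ≤ objective (diffOp G k) lamG lam X y b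

/-- The constraint `‖Θ S - I‖_∞ ≤ μ` (element-wise) of the CLIME program. -/
def ClimeFeasible (S : Matrix (Fin n) (Fin n) ℝ) (μ : ℝ) (Θ : Matrix (Fin n) (Fin n) ℝ) : Prop :=
  matMax (Θ * S - 1) ≤ μ

/-- `Θ` solves the CLIME program: it minimizes `‖Θ‖_{1,1}` subject to the constraint. -/
def IsClime (S : Matrix (Fin n) (Fin n) ℝ) (μ : ℝ) (Θ : Matrix (Fin n) (Fin n) ℝ) : Prop :=
  ClimeFeasible S μ Θ ∧ ∀ Θ', ClimeFeasible S μ Θ' → l11 Θ ≤ l11 Θ'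

/-- The one-step estimator `β + Θ Xᵀ (y - X β) / N`. -/
def oneStep (Θ : Matrix (Fin n) (Fin n) ℝ) (X : Matrix (Fin N) (Fin n) ℝ) (y : Fin N → ℝ)
    (β : Fin n → ℝ) : Fin n → ℝ :=
  β + (1 / (N : ℝ)) • ((Θ * Xᵀ) *ᵥ (y - X *ᵥ β))

/-- The noise term `Δ Θ Xᵀ ε / √N`. -/
def noiseTerm {m : Type*} (D : Matrix m (Fin n) ℝ) (Θ : Matrix (Fin n) (Fin n) ℝ)
    (X : Matrix (Fin N) (Fin n) ℝ) (ε : Fin N → ℝ) : m → ℝ :=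
  (1 / √(N : ℝ)) • ((D * Θ * Xᵀ) *ᵥ ε)

/-- The remainder `√N Δ (Θ Σ_N - I) (β - β*)`. -/
def remainder {m : Type*} (D : Matrix m (Fin n) ℝ) (Θ : Matrix (Fin n) (Fin n) ℝ)
    (X : Matrix (Fin N) (Fin n) ℝ) (β βstar : Fin n → ℝ) : m → ℝ :=
  √(N : ℝ) • ((D * (Θ * sampleGram X - 1)) *ᵥ (β - βstar))

/-- The sandwich covariance matrix `Δ Θ Σ_N Θᵀ Δᵀ`. -/
def sandwich {m : Type*} (D : Matrix m (Fin n) ℝ) (Θ : Matrix (Fin n) (Fin n) ℝ)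
    (X : Matrix (Fin N) (Fin n) ℝ) : Matrix m m ℝ :=
  D * Θ * sampleGram X * Θᵀ * Dᵀ

end Estimators

end

end GPPL

open GPPL

/-!
The first assertion is an algebraic identity. Given `X`, the noise term is a linear image of `ε`,
which gives its conditional law.

The absolute row sums of `Δ^{(k+1)}` are at most `(2d)^{(k+1)/2}`, so the remainder is at most
`√N (2d)^{(k+1)/2} μ ‖β̂ - β*‖₁`. The same row sums bound the error of the sandwich covariance: the
CLIME program decouples over rows, hence each row of `Θ̂` is dominated in `ℓ₁`-norm by the
corresponding row of the feasible matrix `Θ_x`, which `M_n` controls.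

The `ℓ₁`-error of `β̂` is `O(s₂ λ)`. By Schur's test `‖Δ^{(k+1)} v‖₂² ≤ (2d)^{k+1} ‖v‖₂²`, so the
choice of `λ_g` makes the graph penalty on `s₁` coordinates comparable to `√s₂ ‖v‖₂`, and the basic
inequality confines `v = β̂ - β*` to a cone `‖v‖₁ ≲ √s₂ ‖v‖₂`. On this cone `Σ_N` is coercive: by
Maurey's empirical method `v` is an average of sums of `O(s₂)` signed basis vectors, and on these
finitely many sums coercivity follows from Bernstein's inequality and a union bound. All the
exceptional events have probability `O(1 / n)`.
-/

namespace GPPL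

/-! ### Row sums and the Schur test -/

section Schur

variable {l m n : Type*} [Fintype m] [Fintype n]

theorem mulVec_dotProduct_self_le_of_sum_abs_le (A : Matrix m n ℝ) {r c : ℝ} (hr0 : 0 ≤ r)
    (hr : ∀ i, ∑ j, |A i j| ≤ r) (hc : ∀ j, ∑ i, |A i j| ≤ c) (v : n → ℝ) :
    (A *ᵥ v) ⬝ᵥ (A *ᵥ v) ≤ r * c * (v ⬝ᵥ v) := by
  simp only [dotProduct, ← sq]
  have entry_le (i : m) : (A *ᵥ v) i ^ 2 ≤ r * ∑ j, |A i j| * v j ^ 2 :=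
    calc (A *ᵥ v) i ^ 2 ≤ (∑ j, |A i j|) * ∑ j, |A i j| * v j ^ 2 := by
          refine Finset.sum_sq_le_sum_mul_sum_of_sq_le_mul _ (fun j _ => abs_nonneg _)
            (fun j _ => by positivity) (fun j _ => le_of_eq ?_)
          rw [mul_pow, ← sq_abs (A i j)]
          ring
      _ ≤ r * ∑ j, |A i j| * v j ^ 2 := by
          gcongr
          exact hr i
  calc ∑ i, (A *ᵥ v) i ^ 2 ≤ ∑ i, r * ∑ j, |A i j| * v j ^ 2 :=
        Finset.sum_le_sum fun i _ => entry_le i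
    _ = r * ∑ j, (∑ i, |A i j|) * v j ^ 2 := by
        rw [← Finset.mul_sum, Finset.sum_comm]
        simp_rw [Finset.sum_mul]
    _ ≤ r * ∑ j, c * v j ^ 2 := by
        gcongr with j _
        exact hc j
    _ = r * c * ∑ j, v j ^ 2 := by rw [← Finset.mul_sum, mul_assoc]

theorem sum_abs_mul_le (A : Matrix l m ℝ) (B : Matrix m n ℝ) {a b : ℝ} (hb0 : 0 ≤ b)
    (hA : ∀ i, ∑ j, |A i j| ≤ a) (hB : ∀ i, ∑ j, |B i j| ≤ b) (i : l) :
    ∑ j, |(A * B) i j| ≤ a * b := by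
  calc ∑ j, |(A * B) i j| ≤ ∑ j, ∑ k, |A i k| * |B k j| := by
        refine Finset.sum_le_sum fun j _ => (Finset.abs_sum_le_sum_abs _ _).trans_eq ?_
        simp_rw [abs_mul]
    _ = ∑ k, |A i k| * ∑ j, |B k j| := by
        rw [Finset.sum_comm]
        simp_rw [Finset.mul_sum]
    _ ≤ ∑ k, |A i k| * b := by
        gcongr with k _
        exact hB k
    _ = (∑ k, |A i k|) * b := by rw [Finset.sum_mul]
    _ ≤ a * b := by
        gcongr
        exact hA i

end Schur

/-! ### Graph difference operators -/

section Graph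

variable {n : ℕ} (G : SimpleGraph (Fin n))

theorem abs_incidence (e : G.edgeSet) (v : Fin n) :
    |incidence G e v| = if v ∈ e.1 then 1 else 0 := by
  obtain ⟨e, he⟩ := e
  induction e using Sym2.ind with
  | _ a b =>
    simp only [incidence, Sym2.inf_mk, Sym2.sup_mk, Sym2.mem_iff]
    rcases le_total a b with h | h
    · simp only [inf_eq_left.2 h, sup_eq_right.2 h]
      split_ifs <;> simp_all
    · simp only [inf_eq_right.2 h, sup_eq_left.2 h]
      split_ifs <;> simp_all

theorem sum_abs_incidence_row_le (e : G.edgeSet) : ∑ v, |incidence G e v| ≤ 2 := by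
  simp_rw [abs_incidence]
  rw [Finset.sum_boole]
  obtain ⟨e, he⟩ := e
  induction e using Sym2.ind with
  | _ a b =>
    have : (Finset.univ.filter fun v => v ∈ s(a, b)) ⊆ {a, b} := by
      intro v
      simp [Sym2.mem_iff]
    exact_mod_cast (Finset.card_le_card this).trans Finset.card_le_two

variable [DecidableRel G.Adj]

theorem sum_abs_incidence_col_le (v : Fin n) :
    ∑ e, |incidence G e v| ≤ (G.maxDegree : ℝ) := by
  simp_rw [abs_incidence]
  rw [Finset.sum_boole]
  have card_le : (Finset.univ.filter fun e : G.edgeSet => v ∈ e.1).card ≤ G.degree v := by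
    rw [← G.card_incidenceFinset_eq_degree]
    refine Finset.card_le_card_of_injOn (fun e => e.1) ?_ Subtype.val_injective.injOn
    intro e he
    have hve : v ∈ e.1 := by simpa using he
    exact Finset.mem_coe.2 ((G.mem_incidenceFinset v e.1).2 ⟨e.2, hve⟩)
  exact_mod_cast card_le.trans (G.degree_le_maxDegree v)

/-- The bound on the absolute row sums of `diffStep G k`, alternating between the maximum degree
(for `Fᵀ`) and `2` (for `F`). The absolute column sums are bounded by the next value. -/
def stepRowBound : ℕ → ℝ
  | 0 => G.maxDegree
  | 1 => 2
  | k + 2 => stepRowBound k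

theorem stepRowBound_nonneg : ∀ k, 0 ≤ stepRowBound G k
  | 0 => Nat.cast_nonneg _
  | 1 => zero_le_two
  | k + 2 => stepRowBound_nonneg k

theorem stepRowBound_mul_stepRowBound_succ : ∀ k,
    stepRowBound G k * stepRowBound G (k + 1) = 2 * G.maxDegree
  | 0 => mul_comm _ _
  | 1 => rfl
  | k + 2 => stepRowBound_mul_stepRowBound_succ k

theorem sum_abs_diffStep_row_le : ∀ k i, ∑ j, |diffStep G k i j| ≤ stepRowBound G k
  | 0 => sum_abs_incidence_col_le G
  | 1 => sum_abs_incidence_row_le G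
  | k + 2 => sum_abs_diffStep_row_le k

theorem sum_abs_diffStep_col_le : ∀ k j, ∑ i, |diffStep G k i j| ≤ stepRowBound G (k + 1)
  | 0 => sum_abs_incidence_row_le G
  | 1 => sum_abs_incidence_col_le G
  | k + 2 => sum_abs_diffStep_col_le k

theorem diffOp_mulVec_dotProduct_self_le (v : Fin n → ℝ) : ∀ k,
    (diffOp G k *ᵥ v) ⬝ᵥ (diffOp G k *ᵥ v) ≤ (2 * (G.maxDegree : ℝ)) ^ (k + 1) * (v ⬝ᵥ v)
  | 0 => by
      rw [zero_add, pow_one]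
      exact mulVec_dotProduct_self_le_of_sum_abs_le (incidence G) zero_le_two
        (sum_abs_incidence_row_le G) (sum_abs_incidence_col_le G) v
  | k + 1 => by
      have step := mulVec_dotProduct_self_le_of_sum_abs_le (diffStep G k) (stepRowBound_nonneg G k)
        (sum_abs_diffStep_row_le G k) (sum_abs_diffStep_col_le G k) (diffOp G k *ᵥ v)
      rw [mulVec_mulVec, stepRowBound_mul_stepRowBound_succ] at step
      refine step.trans ?_
      rw [pow_succ' _ (k + 1), mul_assoc (2 * (G.maxDegree : ℝ)) (_ ^ _)]
      exact mul_le_mul_of_nonneg_left (diffOp_mulVec_dotProduct_self_le v k) (by positivity)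

theorem sum_abs_diffOp_row_le (hd : 2 ≤ G.maxDegree) : ∀ k i,
    ∑ j, |diffOp G k i j| ≤ √((2 * (G.maxDegree : ℝ)) ^ (k + 1))
  | 0, i => by
      have : (2 : ℝ) ≤ G.maxDegree := by exact_mod_cast hd
      refine (sum_abs_incidence_row_le G i).trans (Real.le_sqrt_of_sq_le ?_)
      norm_num
      linarith
  | 1, i => by
      rw [Real.sqrt_sq (by positivity), mul_comm]
      exact sum_abs_mul_le (incidence G)ᵀ (incidence G) zero_le_two
        (sum_abs_incidence_col_le G) (sum_abs_incidence_row_le G) i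
  | k + 2, i => by
      have two_steps : √((2 * (G.maxDegree : ℝ)) ^ (k + 2 + 1)) =
          stepRowBound G (k + 1) * (stepRowBound G k * √((2 * (G.maxDegree : ℝ)) ^ (k + 1))) := by
        rw [show k + 2 + 1 = (k + 1) + 2 by ring, pow_add, Real.sqrt_mul (by positivity),
          Real.sqrt_sq (by positivity), ← stepRowBound_mul_stepRowBound_succ G k]
        ring
      rw [two_steps]
      exact sum_abs_mul_le (diffStep G (k + 1)) (diffStep G k * diffOp G k)
        (mul_nonneg (stepRowBound_nonneg G k) (Real.sqrt_nonneg _))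
        (sum_abs_diffStep_row_le G (k + 1))
        (sum_abs_mul_le _ _ (Real.sqrt_nonneg _) (sum_abs_diffStep_row_le G k)
          (sum_abs_diffOp_row_le hd k)) i

end Graph

/-! ### Quadratic forms and signed sums -/

section L1

variable {ι : Type*} [Fintype ι]

theorem l1_nonneg (v : ι → ℝ) : 0 ≤ l1 v := Finset.sum_nonneg fun i _ => abs_nonneg (v i)

theorem l1_eq_zero {v : ι → ℝ} : l1 v = 0 ↔ v = 0 := by
  simp [l1, Finset.sum_eq_zero_iff_of_nonneg, funext_iff]

theorem l1_smul (a : ℝ) (v : ι → ℝ) : l1 (a • v) = |a| * l1 v := by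
  simp only [l1, Pi.smul_apply, smul_eq_mul, abs_mul, Finset.mul_sum]

end L1

section QuadraticForm

variable {ι : Type*} [Fintype ι] {A : Matrix ι ι ℝ}

theorem dotProduct_mulVec_comm (hA : A.IsSymm) (u v : ι → ℝ) : u ⬝ᵥ A *ᵥ v = v ⬝ᵥ A *ᵥ u := by
  rw [dotProduct_mulVec, ← mulVec_transpose, hA.eq, dotProduct_comm]

theorem add_dotProduct_mulVec_add (hA : A.IsSymm) (u v : ι → ℝ) :
    (u + v) ⬝ᵥ A *ᵥ (u + v) = u ⬝ᵥ A *ᵥ u + 2 * (v ⬝ᵥ A *ᵥ u) + v ⬝ᵥ A *ᵥ v := by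
  rw [mulVec_add, add_dotProduct, dotProduct_add, dotProduct_add, dotProduct_mulVec_comm hA u v]
  ring

theorem abs_dotProduct_mulVec_le_of_add_sub (hA : A.IsSymm) {t : ℝ} {u v : ι → ℝ}
    (hadd : |(u + v) ⬝ᵥ A *ᵥ (u + v)| ≤ t * ((u + v) ⬝ᵥ (u + v)))
    (hsub : |(u - v) ⬝ᵥ A *ᵥ (u - v)| ≤ t * ((u - v) ⬝ᵥ (u - v))) :
    |u ⬝ᵥ A *ᵥ v| ≤ t / 2 * (u ⬝ᵥ u + v ⬝ᵥ v) := by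
  have polarisation :
      4 * (u ⬝ᵥ A *ᵥ v) = (u + v) ⬝ᵥ A *ᵥ (u + v) - (u - v) ⬝ᵥ A *ᵥ (u - v) := by
    rw [sub_eq_add_neg u v, add_dotProduct_mulVec_add hA, add_dotProduct_mulVec_add hA,
      dotProduct_mulVec_comm hA u v]
    simp only [neg_dotProduct, mulVec_neg, dotProduct_neg]
    ring
  have parallelogram :
      (u + v) ⬝ᵥ (u + v) + (u - v) ⬝ᵥ (u - v) = 2 * (u ⬝ᵥ u + v ⬝ᵥ v) := by
    simp only [add_dotProduct, sub_dotProduct, dotProduct_add, dotProduct_sub]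
    ring
  have bound : |4 * (u ⬝ᵥ A *ᵥ v)| ≤ t * (2 * (u ⬝ᵥ u + v ⬝ᵥ v)) := by
    rw [polarisation, ← parallelogram, mul_add]
    exact (abs_sub _ _).trans (add_le_add hadd hsub)
  rw [abs_mul, abs_of_pos four_pos] at bound
  linarith

end QuadraticForm

section SignedSum

variable {ι : Type*} [DecidableEq ι]

/-- The standard basis vector at `p.1`, with the sign given by `p.2` (`true` is `+1`). The convex
hull of these vectors is the unit ball of the `ℓ₁`-norm. -/
noncomputable def signedBasis (p : ι × Bool) : ι → ℝ := Pi.single p.1 (if p.2 then 1 else -1)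

/-- The sum of a finite family of signed standard basis vectors. Such sums are the sparse integer
vectors on which a restricted eigenvalue condition is tested. -/
noncomputable def signedSum {m : ℕ} (f : Fin m → ι × Bool) : ι → ℝ := ∑ l, signedBasis (f l)

variable [Fintype ι] {A : Matrix ι ι ℝ}

theorem signedBasis_dotProduct_mulVec_self (A : Matrix ι ι ℝ) (p : ι × Bool) :
    signedBasis p ⬝ᵥ A *ᵥ signedBasis p = A p.1 p.1 := by
  simp only [signedBasis, single_dotProduct, mulVec_single]
  split_ifs <;> simp

theorem abs_mul_signedBasis_dotProduct (a : ℝ) (j : ι) (w : ι → ℝ) :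
    |a| * (signedBasis (j, decide (0 ≤ a)) ⬝ᵥ w) = a * w j := by
  simp only [signedBasis, single_dotProduct, decide_eq_true_eq]
  split_ifs with h
  · rw [abs_of_nonneg h, one_mul]
  · rw [abs_of_neg (not_le.1 h)]
    ring

-- Draw the basis vector `± e_j` with probability `|v j|` and the sign of `v j`: its mean is `v`,
-- so averaging the hypothesis leaves the variance term `C - vᵀ A v`.
theorem le_quadForm_add_of_forall_signedBasis (hA : A.IsSymm) {C B : ℝ}
    (hC : ∀ j, A j j ≤ C) {u v : ι → ℝ} (hv : l1 v = 1)
    (h : ∀ p : ι × Bool, B ≤ (u + signedBasis p) ⬝ᵥ A *ᵥ (u + signedBasis p)) :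
    B ≤ (u + v) ⬝ᵥ A *ᵥ (u + v) + (C - v ⬝ᵥ A *ᵥ v) := by
  have weighted (j : ι) :
      |v j| * B ≤ |v j| * (u ⬝ᵥ A *ᵥ u) + 2 * (v j * (A *ᵥ u) j) + |v j| * C := by
    have hj := h (j, decide (0 ≤ v j))
    rw [add_dotProduct_mulVec_add hA, signedBasis_dotProduct_mulVec_self] at hj
    have signed := abs_mul_signedBasis_dotProduct (v j) j (A *ᵥ u)
    have scaled := mul_le_mul_of_nonneg_left (hj.trans (add_le_add_right (hC j) _))
      (abs_nonneg (v j))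
    linear_combination scaled + 2 * signed
  have averaged : l1 v * B ≤ l1 v * (u ⬝ᵥ A *ᵥ u) + 2 * (v ⬝ᵥ A *ᵥ u) + l1 v * C := by
    simpa only [l1, dotProduct, Finset.sum_add_distrib, ← Finset.mul_sum, ← Finset.sum_mul] using
      Finset.sum_le_sum fun j (_ : j ∈ Finset.univ) => weighted j
  rw [hv] at averaged
  rw [add_dotProduct_mulVec_add hA]
  linarith

theorem le_quadForm_add_smul_of_forall_signedSum (hA : A.IsSymm) {C B : ℝ}
    (hC : ∀ j, A j j ≤ C) {v : ι → ℝ} (hv : l1 v = 1) :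
    ∀ (m : ℕ) (u : ι → ℝ),
      (∀ f : Fin m → ι × Bool, B ≤ (u + signedSum f) ⬝ᵥ A *ᵥ (u + signedSum f)) →
      B ≤ (u + (m : ℝ) • v) ⬝ᵥ A *ᵥ (u + (m : ℝ) • v) + m * (C - v ⬝ᵥ A *ᵥ v)
  | 0, u, h => by simpa [signedSum] using h Fin.elim0
  | m + 1, u, h => by
      have first_fixed (p : ι × Bool) : B - m * (C - v ⬝ᵥ A *ᵥ v) ≤
          (u + (m : ℝ) • v + signedBasis p) ⬝ᵥ A *ᵥ (u + (m : ℝ) • v + signedBasis p) := by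
        have tail := le_quadForm_add_smul_of_forall_signedSum hA hC hv m (u + signedBasis p)
          fun f => by
            have cons := h (Fin.cons p f)
            rwa [signedSum, Fin.sum_univ_succ, Fin.cons_zero, ← add_assoc] at cons
        rw [add_right_comm]
        linarith
      have averaged := le_quadForm_add_of_forall_signedBasis hA hC hv first_fixed
      rw [add_assoc, show (m : ℝ) • v + v = ((m + 1 : ℕ) : ℝ) • v by push_cast; module] at averaged
      push_cast at averaged ⊢
      linarith

theorem quadForm_nonneg_of_forall_signedSum (hA : A.IsSymm) {C : ℝ}
    (hC : ∀ j, A j j ≤ C) {m : ℕ} (hm : 0 < m)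
    (h : ∀ f : Fin m → ι × Bool, 0 ≤ signedSum f ⬝ᵥ A *ᵥ signedSum f) (v : ι → ℝ) :
    0 ≤ ((m : ℝ) - 1) * (v ⬝ᵥ A *ᵥ v) + C * l1 v ^ 2 := by
  have hm' : (0 : ℝ) < m := by exact_mod_cast hm
  rcases (l1_nonneg v).eq_or_lt' with h0 | hpos
  · simp [l1_eq_zero.1 h0, l1]
  have normalised : l1 ((l1 v)⁻¹ • v) = 1 := by
    rw [l1_smul, abs_of_pos (inv_pos.2 hpos), inv_mul_cancel₀ hpos.ne']
  have averaged := le_quadForm_add_smul_of_forall_signedSum hA hC normalised m 0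
    (fun f => by simpa using h f)
  simp only [zero_add, mulVec_smul, smul_dotProduct, dotProduct_smul, smul_eq_mul] at averaged
  set q := v ⬝ᵥ A *ᵥ v
  have rescaled : m * ((m - 1) * q + C * l1 v ^ 2) =
      l1 v ^ 2 * (m * ((l1 v)⁻¹ * (m * ((l1 v)⁻¹ * q))) +
        m * (C - (l1 v)⁻¹ * ((l1 v)⁻¹ * q))) := by
    field_simp
    ring
  refine nonneg_of_mul_nonneg_right ?_ hm'
  rw [rescaled]
  exact mul_nonneg (sq_nonneg _) averaged

theorem quadForm_lower_bound_of_forall_signedSum (hA : A.IsSymm) {C c : ℝ}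
    (hc : 0 ≤ c) (hC : ∀ j, A j j ≤ C) {m : ℕ} (hm : 0 < m)
    (h : ∀ f : Fin m → ι × Bool,
      c * (signedSum f ⬝ᵥ signedSum f) ≤ signedSum f ⬝ᵥ A *ᵥ signedSum f) (v : ι → ℝ) :
    0 ≤ ((m : ℝ) - 1) * (v ⬝ᵥ A *ᵥ v - c * (v ⬝ᵥ v)) + C * l1 v ^ 2 := by
  have shifted (w : ι → ℝ) : w ⬝ᵥ (A - c • (1 : Matrix ι ι ℝ)) *ᵥ w =
      w ⬝ᵥ A *ᵥ w - c * (w ⬝ᵥ w) := by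
    simp [sub_mulVec, smul_mulVec]
  rw [← shifted]
  refine quadForm_nonneg_of_forall_signedSum (hA.sub (isSymm_one.smul c))
    (fun j => by simpa using (hC j).trans (by linarith)) hm (fun f => ?_) v
  rw [shifted]
  linarith [h f]

end SignedSum

/-! ### The doubly penalized least squares estimator -/

section L1Difference

variable {ι : Type*} [Fintype ι]

theorem abs_dotProduct_le_of_abs_le {a v : ι → ℝ} {B : ℝ} (h : ∀ i, |a i| ≤ B) :
    |v ⬝ᵥ a| ≤ B * l1 v := by
  rw [dotProduct, l1, Finset.mul_sum]
  refine (Finset.abs_sum_le_sum_abs _ _).trans (Finset.sum_le_sum fun i _ => ?_)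
  rw [abs_mul, mul_comm]
  exact mul_le_mul_of_nonneg_right (h i) (abs_nonneg _)

theorem sum_support_abs_le (b w : ι → ℝ) [DecidablePred fun i => b i ≠ 0] :
    ∑ i with b i ≠ 0, |w i| ≤ √(l0 b) * √(w ⬝ᵥ w) := by
  have card_eq : ((Finset.univ.filter fun i => b i ≠ 0).card : ℝ) = l0 b := by
    rw [l0, Set.ncard_eq_toFinset_card']
    congr 2
    ext
    simp
  rw [← card_eq, ← Real.sqrt_mul (by positivity)]
  refine Real.le_sqrt_of_sq_le (sq_sum_le_card_mul_sum_sq.trans ?_)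
  simp_rw [sq_abs, dotProduct, ← sq]
  gcongr
  exact Finset.subset_univ _

theorem l1_sub_l1_add_le (b w : ι → ℝ) [DecidablePred fun i => b i ≠ 0] :
    l1 b - l1 (b + w) ≤ 2 * (∑ i with b i ≠ 0, |w i|) - l1 w := by
  have entry_le (i : ι) : |b i| - |(b + w) i| ≤ 2 * (if b i ≠ 0 then |w i| else 0) - |w i| := by
    simp only [Pi.add_apply]
    split_ifs with h
    · have := abs_sub_abs_le_abs_sub (b i) (b i + w i)
      rw [sub_add_cancel_left, abs_neg] at this
      linarith
    · simp [not_not.1 h]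
  simpa only [l1, Finset.sum_sub_distrib, ← Finset.mul_sum, ← Finset.sum_filter] using
    Finset.sum_le_sum fun i (_ : i ∈ Finset.univ) => entry_le i

theorem l1_sub_l1_add_le_sqrt (b w : ι → ℝ) :
    l1 b - l1 (b + w) ≤ √(l0 b) * √(w ⬝ᵥ w) := by
  classical
  have support_le : ∑ i with b i ≠ 0, |w i| ≤ l1 w :=
    Finset.sum_le_sum_of_subset_of_nonneg (Finset.subset_univ _) fun _ _ _ => abs_nonneg _
  linarith [l1_sub_l1_add_le b w, sum_support_abs_le b w]

theorem l1_sub_l1_add_le_two_sqrt (b w : ι → ℝ) :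
    l1 b - l1 (b + w) ≤ 2 * (√(l0 b) * √(w ⬝ᵥ w)) - l1 w := by
  classical
  linarith [l1_sub_l1_add_le b w, sum_support_abs_le b w]

end L1Difference

section Lasso

variable {N n : ℕ}

theorem sampleGram_isSymm (X : Matrix (Fin N) (Fin n) ℝ) : (sampleGram X).IsSymm := by
  simp [IsSymm, sampleGram, transpose_mul]

theorem quadForm_sampleGram (X : Matrix (Fin N) (Fin n) ℝ) (v : Fin n → ℝ) :
    v ⬝ᵥ sampleGram X *ᵥ v = 1 / N * ∑ i, (X *ᵥ v) i ^ 2 := by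
  rw [sampleGram, smul_mulVec, dotProduct_smul, smul_eq_mul, ← mulVec_mulVec, dotProduct_mulVec,
    vecMul_transpose]
  simp [dotProduct, sq]

variable {m : Type*} [Fintype m]

theorem objective_add_sub_objective (D : Matrix m (Fin n) ℝ) (lamG lam : ℝ)
    (X : Matrix (Fin N) (Fin n) ℝ) (β v : Fin n → ℝ) (ε : Fin N → ℝ) :
    objective D lamG lam X (response X β ε) (β + v) -
        objective D lamG lam X (response X β ε) β =
      v ⬝ᵥ sampleGram X *ᵥ v / 2 - 1 / N * (v ⬝ᵥ Xᵀ *ᵥ ε) +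
        lamG * (l1 (D *ᵥ (β + v)) - l1 (D *ᵥ β)) + lam * (l1 (β + v) - l1 β) := by
  have residual : ∑ i, (response X β ε i - (X *ᵥ (β + v)) i) ^ 2 =
      ∑ i, (response X β ε i - (X *ᵥ β) i) ^ 2 - 2 * (v ⬝ᵥ Xᵀ *ᵥ ε) + ∑ i, (X *ᵥ v) i ^ 2 := by
    rw [dotProduct_mulVec, vecMul_transpose, dotProduct, Finset.mul_sum, ← Finset.sum_sub_distrib,
      ← Finset.sum_add_distrib]
    refine Finset.sum_congr rfl fun i _ => ?_
    simp only [response, mulVec_add, Pi.add_apply]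
    ring
  rw [objective, objective, residual, quadForm_sampleGram]
  ring

theorem mul_l1_sub_l1_mulVec_add_le {D : Matrix m (Fin n) ℝ} {lam ν B : ℝ} (hlam : 0 ≤ lam)
    (hν : 0 ≤ ν) (hB : 0 < B)
    (hD : ∀ v : Fin n → ℝ, (D *ᵥ v) ⬝ᵥ (D *ᵥ v) ≤ B * (v ⬝ᵥ v)) {β : Fin n → ℝ} {s₁ s₂ : ℕ}
    (hs₁ : l0 (D *ᵥ β) ≤ s₁) (hs : ν * s₁ ≤ s₂) (v : Fin n → ℝ) :
    lam * √(ν / B) * (l1 (D *ᵥ β) - l1 (D *ᵥ (β + v))) ≤ lam * (√s₂ * √(v ⬝ᵥ v)) := by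
  have difference_le : l1 (D *ᵥ β) - l1 (D *ᵥ (β + v)) ≤ √s₁ * (√B * √(v ⬝ᵥ v)) := by
    rw [mulVec_add]
    refine (l1_sub_l1_add_le_sqrt _ _).trans ?_
    rw [← Real.sqrt_mul hB.le]
    gcongr
    exact hD v
  have balance : √(ν / B) * (√s₁ * √B) ≤ √s₂ := by
    rw [← Real.sqrt_mul (by positivity), ← Real.sqrt_mul (by positivity)]
    refine Real.sqrt_le_sqrt (le_of_eq_of_le ?_ hs)
    field_simp
  calc lam * √(ν / B) * (l1 (D *ᵥ β) - l1 (D *ᵥ (β + v)))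
      ≤ lam * √(ν / B) * (√s₁ * (√B * √(v ⬝ᵥ v))) := by gcongr
    _ = lam * (√(ν / B) * (√s₁ * √B) * √(v ⬝ᵥ v)) := by ring
    _ ≤ lam * (√s₂ * √(v ⬝ᵥ v)) := by gcongr

theorem lasso_basic_inequality (hN : 0 < N) {D : Matrix m (Fin n) ℝ} {lam ν B : ℝ}
    (hlam : 0 ≤ lam) (hν : 0 ≤ ν) (hB : 0 < B)
    (hD : ∀ v : Fin n → ℝ, (D *ᵥ v) ⬝ᵥ (D *ᵥ v) ≤ B * (v ⬝ᵥ v))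
    {X : Matrix (Fin N) (Fin n) ℝ} {β v : Fin n → ℝ} {ε : Fin N → ℝ} {s₁ s₂ : ℕ}
    (hs₁ : l0 (D *ᵥ β) ≤ s₁) (hs₂ : l0 β ≤ s₂) (hs : ν * s₁ ≤ s₂)
    (hmin : objective D (lam * √(ν / B)) lam X (response X β ε) (β + v) ≤
      objective D (lam * √(ν / B)) lam X (response X β ε) β)
    (hnoise : ∀ j, |(Xᵀ *ᵥ ε) j| ≤ N * (lam / 2)) :
    v ⬝ᵥ sampleGram X *ᵥ v + lam * l1 v ≤ 6 * (lam * (√s₂ * √(v ⬝ᵥ v))) := by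
  have hN' : (0 : ℝ) < N := by exact_mod_cast hN
  have increment := objective_add_sub_objective D (lam * √(ν / B)) lam X β v ε
  have noise : 1 / (N : ℝ) * (v ⬝ᵥ Xᵀ *ᵥ ε) ≤ lam / 2 * l1 v := by
    rw [div_mul_eq_mul_div, one_mul, div_le_iff₀' hN', ← mul_assoc]
    exact (le_abs_self _).trans (abs_dotProduct_le_of_abs_le hnoise)
  have graph := mul_l1_sub_l1_mulVec_add_le hlam hν hB hD hs₁ hs v
  have sparse : l1 β - l1 (β + v) ≤ 2 * (√s₂ * √(v ⬝ᵥ v)) - l1 v := by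
    refine (l1_sub_l1_add_le_two_sqrt _ _).trans ?_
    gcongr
  linarith [mul_le_mul_of_nonneg_left sparse hlam]

end Lasso

section RestrictedEigenvalue

variable {ι : Type*} [Fintype ι] {v : ι → ℝ} {c C q R s : ℝ}

theorem half_mul_dotProduct_self_le_of_l1_le (hs : 0 < s) (hR : 0 < R) (hC : 0 ≤ C)
    (hRC : 72 * C ≤ c * R) (hl1 : l1 v ≤ 6 * (√s * √(v ⬝ᵥ v)))
    (hre : 0 ≤ R * s * (q - c * (v ⬝ᵥ v)) + C * l1 v ^ 2) : c / 2 * (v ⬝ᵥ v) ≤ q := by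
  have hvv : 0 ≤ v ⬝ᵥ v := by simpa using dotProduct_star_self_nonneg v
  have l1_sq_le : l1 v ^ 2 ≤ 36 * s * (v ⬝ᵥ v) := by
    refine (pow_le_pow_left₀ (l1_nonneg v) hl1 2).trans_eq ?_
    rw [mul_pow, mul_pow, Real.sq_sqrt hs.le, Real.sq_sqrt hvv]
    ring
  have absorbed : R * s * (c / 2 * (v ⬝ᵥ v)) ≤ R * s * q := by
    linarith [mul_le_mul_of_nonneg_left l1_sq_le hC,
      mul_le_mul_of_nonneg_right hRC (mul_nonneg hs.le hvv)]
  exact le_of_mul_le_mul_left absorbed (mul_pos hR hs)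

theorem l1_le_of_basic_inequality {lam : ℝ} (hlam : 0 < lam) (hc : 0 < c) (hs : 0 < s)
    (hR : 0 < R) (hC : 0 ≤ C) (hRC : 72 * C ≤ c * R) (hq : 0 ≤ q)
    (hbasic : q + lam * l1 v ≤ 6 * (lam * (√s * √(v ⬝ᵥ v))))
    (hre : 0 ≤ R * s * (q - c * (v ⬝ᵥ v)) + C * l1 v ^ 2) : l1 v ≤ 72 * lam * s / c := by
  have hl1 : l1 v ≤ 6 * (√s * √(v ⬝ᵥ v)) :=
    le_of_mul_le_mul_left (by linarith : lam * l1 v ≤ lam * (6 * (√s * √(v ⬝ᵥ v)))) hlam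
  have curvature := half_mul_dotProduct_self_le_of_l1_le hs hR hC hRC hl1 hre
  have hvv : 0 ≤ v ⬝ᵥ v := by simpa using dotProduct_star_self_nonneg v
  set r := √(v ⬝ᵥ v)
  have norm_le : c * r ≤ 12 * lam * √s := by
    rcases (Real.sqrt_nonneg (v ⬝ᵥ v)).eq_or_lt' with h0 | hpos
    · rw [show r = 0 from h0, mul_zero]
      positivity
    · refine le_of_mul_le_mul_left ?_ hpos
      rw [← Real.sq_sqrt hvv] at curvature
      linarith [mul_nonneg hlam.le (l1_nonneg v)]
  rw [le_div_iff₀ hc]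
  calc l1 v * c ≤ 6 * (√s * r) * c := by gcongr
    _ = 6 * √s * (c * r) := by ring
    _ ≤ 6 * √s * (12 * lam * √s) := by gcongr
    _ = 72 * lam * √s ^ 2 := by ring
    _ = 72 * lam * s := by rw [Real.sq_sqrt hs.le]

end RestrictedEigenvalue

/-! ### The CLIME program -/

section EntrywiseBounds

variable {l m n : Type*}

theorem vecMax_nonneg (v : l → ℝ) : 0 ≤ vecMax v := Real.iSup_nonneg fun _ => abs_nonneg _

theorem vecMax_le {v : l → ℝ} {B : ℝ} (hB : 0 ≤ B) (h : ∀ i, |v i| ≤ B) : vecMax v ≤ B :=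
  Real.iSup_le h hB

theorem matMax_nonneg (A : Matrix l m ℝ) : 0 ≤ matMax A :=
  Real.iSup_nonneg fun _ => Real.iSup_nonneg fun _ => abs_nonneg _

theorem matMax_le {A : Matrix l m ℝ} {B : ℝ} (hB : 0 ≤ B) (h : ∀ i j, |A i j| ≤ B) :
    matMax A ≤ B :=
  Real.iSup_le (fun i => Real.iSup_le (h i) hB) hB

theorem abs_le_matMax [Finite l] [Finite m] (A : Matrix l m ℝ) (i : l) (j : m) :
    |A i j| ≤ matMax A :=
  (le_ciSup (f := fun j => |A i j|) (Set.finite_range _).bddAbove j).trans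
    (le_ciSup (f := fun i => ⨆ j, |A i j|) (Set.finite_range _).bddAbove i)

variable [Fintype m]

theorem opInf_nonneg (A : Matrix l m ℝ) : 0 ≤ opInf A :=
  Real.iSup_nonneg fun _ => Finset.sum_nonneg fun _ _ => abs_nonneg _

theorem sum_abs_row_le_opInf [Finite l] (A : Matrix l m ℝ) (i : l) : ∑ j, |A i j| ≤ opInf A :=
  le_ciSup (f := fun i => ∑ j, |A i j|) (Set.finite_range _).bddAbove i

theorem abs_mul_le {A : Matrix l m ℝ} {B : Matrix m n ℝ} {r b : ℝ} (hb : 0 ≤ b)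
    (hA : ∀ i, ∑ j, |A i j| ≤ r) (hB : ∀ i j, |B i j| ≤ b) (i : l) (j : n) :
    |(A * B) i j| ≤ r * b := by
  have row_le := abs_dotProduct_le_of_abs_le (v := A i) fun a => hB a j
  rw [mul_comm r b]
  exact row_le.trans (mul_le_mul_of_nonneg_left (hA i) hb)

theorem abs_mul_transpose_le {A : Matrix n m ℝ} {B : Matrix l m ℝ} {r b : ℝ} (hb : 0 ≤ b)
    (hA : ∀ i, ∑ j, |A i j| ≤ r) (hB : ∀ i j, |B i j| ≤ b) (i : l) (j : n) :
    |(B * Aᵀ) i j| ≤ r * b := by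
  have swapped := abs_mul_le (B := Bᵀ) hb hA (fun i j => hB j i) j i
  rwa [← transpose_apply (A * Bᵀ), transpose_mul, transpose_transpose] at swapped

theorem abs_mul_mul_transpose_le {D : Matrix l m ℝ} {K : Matrix m m ℝ} {b r : ℝ} (hb : 0 ≤ b)
    (hr : 0 ≤ r) (hD : ∀ i, ∑ j, |D i j| ≤ r) (hK : ∀ i j, |K i j| ≤ b) (i j : l) :
    |(D * K * Dᵀ) i j| ≤ r ^ 2 * b := by
  rw [sq, mul_assoc]
  exact abs_mul_transpose_le (mul_nonneg hr hb) hD (abs_mul_le hb hD hK) i j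

end EntrywiseBounds

section Clime

variable {n : ℕ} {Sg Θ T : Matrix (Fin n) (Fin n) ℝ} {μ : ℝ}

-- The program decouples over the rows of `Θ`, so replacing one row by a feasible one cannot help.
theorem IsClime.sum_abs_row_le (h : IsClime Sg μ Θ) (hT : ClimeFeasible Sg μ T) (i : Fin n) :
    ∑ j, |Θ i j| ≤ ∑ j, |T i j| := by
  have replaced_feasible : ClimeFeasible Sg μ (Θ.updateRow i (T i)) := by
    refine matMax_le ((matMax_nonneg _).trans hT) fun a b => ?_
    by_cases ha : a = i
    · subst ha
      simpa [Matrix.sub_apply, mul_apply, updateRow_self] using (abs_le_matMax _ a b).trans hT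
    · simpa [Matrix.sub_apply, mul_apply, updateRow_ne ha] using (abs_le_matMax _ a b).trans h.1
  have l11_le := h.2 _ replaced_feasible
  have other_rows : ∑ a ∈ Finset.univ.erase i, ∑ j, |Θ.updateRow i (T i) a j| =
      ∑ a ∈ Finset.univ.erase i, ∑ j, |Θ a j| :=
    Finset.sum_congr rfl fun a ha => by rw [updateRow_ne (Finset.ne_of_mem_erase ha)]
  rw [l11, l11, ← Finset.add_sum_erase _ _ (Finset.mem_univ i),
    ← Finset.add_sum_erase _ (fun a => ∑ j, |Θ.updateRow i (T i) a j|) (Finset.mem_univ i),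
    other_rows, updateRow_self] at l11_le
  exact le_of_add_le_add_right l11_le

theorem IsClime.abs_sandwich_sub_le {M : ℝ} (h : IsClime Sg μ Θ) (hSg : Sg.IsSymm)
    (hT : T.IsSymm) (hfeas : ClimeFeasible Sg μ T) (hM : opInf T ≤ M) (i j : Fin n) :
    |(Θ * Sg * Θᵀ - T) i j| ≤ 3 * (M * μ) := by
  have hμ : 0 ≤ μ := (matMax_nonneg _).trans hfeas
  have sum_T_le (i) : ∑ j, |T i j| ≤ M := (sum_abs_row_le_opInf T i).trans hM
  have sum_Θ_le (i) : ∑ j, |Θ i j| ≤ M := (h.sum_abs_row_le hfeas i).trans (sum_T_le i)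
  have constraint_Θ (i j) : |(Θ * Sg - 1) i j| ≤ μ := (abs_le_matMax _ i j).trans h.1
  have constraint_T (i j) : |(T * Sg - 1) i j| ≤ μ := (abs_le_matMax _ i j).trans hfeas
  have split : Θ * Sg * Θᵀ - T =
      (Θ * Sg - 1) * Θᵀ - (T * Sg - 1) * Θᵀ + ((Θ * Sg - 1) * Tᵀ)ᵀ := by
    simp only [transpose_mul, transpose_sub, hSg.eq, hT.eq, sub_mul, one_mul, Matrix.mul_assoc]
    abel
  rw [split, Matrix.add_apply, Matrix.sub_apply, transpose_apply]
  refine (abs_add_le _ _).trans ((add_le_add_left (abs_sub _ _) _).trans ?_)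
  linarith [abs_mul_transpose_le hμ sum_Θ_le constraint_Θ i j,
    abs_mul_transpose_le hμ sum_Θ_le constraint_T i j,
    abs_mul_transpose_le hμ sum_T_le constraint_Θ j i]

theorem climeFeasible_zero (Sg : Matrix (Fin n) (Fin n) ℝ) (hμ : 1 ≤ μ) :
    ClimeFeasible Sg μ 0 := by
  refine matMax_le (by linarith) fun i j => ?_
  rw [Matrix.zero_mul, zero_sub, neg_apply, abs_neg, one_apply]
  split_ifs <;> simp <;> linarith

theorem IsClime.eq_zero (h : IsClime Sg μ Θ) (hμ : 1 ≤ μ) : Θ = 0 := by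
  ext i j
  have row_le : l1 (Θ i) ≤ 0 := by
    simpa [l1] using h.sum_abs_row_le (climeFeasible_zero Sg hμ) i
  exact congrFun (l1_eq_zero.1 (row_le.antisymm (l1_nonneg _))) j

end Clime

/-! ### The one-step estimator -/

section OneStep

variable {N n : ℕ} {m : Type*} {D : Matrix m (Fin n) ℝ} {X : Matrix (Fin N) (Fin n) ℝ}
  {Θ T : Matrix (Fin n) (Fin n) ℝ} {r μ M : ℝ}

theorem sqrt_smul_mulVec_oneStep_sub (hN : 0 < N) (D : Matrix m (Fin n) ℝ)
    (Θ : Matrix (Fin n) (Fin n) ℝ) (X : Matrix (Fin N) (Fin n) ℝ) (βstar β : Fin n → ℝ)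
    (ε : Fin N → ℝ) :
    √(N : ℝ) • (D *ᵥ oneStep Θ X (response X βstar ε) β - D *ᵥ βstar) =
      noiseTerm D Θ X ε - remainder D Θ X β βstar := by
  have scaling : 1 / √(N : ℝ) = √(N : ℝ) * (1 / N) := by
    have : (0 : ℝ) < N := by exact_mod_cast hN
    rw [mul_one_div, Real.sqrt_div_self']
  rw [noiseTerm, remainder, scaling, mul_smul, ← smul_sub]
  congr 1
  simp only [oneStep, response, sampleGram, mulVec_add, mulVec_sub, mulVec_smul, mulVec_mulVec,
    Matrix.mul_sub, sub_mulVec, Matrix.mul_smul, smul_mulVec, Matrix.mul_assoc, Matrix.mul_one,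
    smul_add, smul_sub]
  abel

theorem ClimeFeasible.vecMax_remainder_le (hΘ : ClimeFeasible (sampleGram X) μ Θ) (hr : 0 ≤ r)
    (hD : ∀ i, ∑ j, |D i j| ≤ r) (β βstar : Fin n → ℝ) :
    vecMax (remainder D Θ X β βstar) ≤ √(N : ℝ) * (r * μ * l1 (β - βstar)) := by
  have hμ : 0 ≤ μ := (matMax_nonneg _).trans hΘ
  have hl1 := l1_nonneg (β - βstar)
  refine vecMax_le (by positivity) fun i => ?_
  rw [remainder, Pi.smul_apply, smul_eq_mul, abs_mul, abs_of_nonneg (Real.sqrt_nonneg _)]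
  refine mul_le_mul_of_nonneg_left ?_ (Real.sqrt_nonneg _)
  rw [mulVec, dotProduct_comm]
  exact abs_dotProduct_le_of_abs_le
    (abs_mul_le hμ hD (fun i j => (abs_le_matMax _ i j).trans hΘ) i)

theorem IsClime.matMax_sandwich_sub_le (h : IsClime (sampleGram X) μ Θ) (hr : 0 ≤ r)
    (hD : ∀ i, ∑ j, |D i j| ≤ r) (hT : T.IsSymm) (hM : opInf T ≤ M)
    (hfeas : 1 ≤ μ ∨ ClimeFeasible (sampleGram X) μ T) :
    matMax (sandwich D Θ X - D * T * Dᵀ) ≤ r ^ 2 * (3 * (M * μ)) := by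
  have hμ : 0 ≤ μ := (matMax_nonneg _).trans h.1
  have hM0 : 0 ≤ M := (opInf_nonneg T).trans hM
  have factored : sandwich D Θ X - D * T * Dᵀ = D * (Θ * sampleGram X * Θᵀ - T) * Dᵀ := by
    simp only [sandwich, Matrix.mul_sub, Matrix.sub_mul, Matrix.mul_assoc]
  rw [factored]
  refine matMax_le (by positivity) fun i j =>
    abs_mul_mul_transpose_le (by positivity) hr hD (fun i j => ?_) i j
  rcases hfeas with one_le | feasible
  · have entry_le : |T i j| ≤ M := (Finset.single_le_sum (f := fun j => |T i j|)
      (fun j _ => abs_nonneg _) (Finset.mem_univ j)).trans ((sum_abs_row_le_opInf T i).trans hM)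
    rw [h.eq_zero one_le, Matrix.zero_mul, Matrix.zero_mul, zero_sub, neg_apply, abs_neg]
    nlinarith
  · exact h.abs_sandwich_sub_le (sampleGram_isSymm X) hT feasible hM i j

end OneStep

section ErrorBound

variable {N n : ℕ}

/-- The restricted conditioning of a Gram matrix that the error bound for the lasso requires: its
diagonal is at most `C`, and its quadratic form is at least `c` times the squared Euclidean norm
on all sums of `m` signed basis vectors. -/
def IsSparselyConditioned (A : Matrix (Fin n) (Fin n) ℝ) (c C : ℝ) (m : ℕ) : Prop :=
  (∀ j, A j j ≤ C) ∧ ∀ f : Fin m → Fin n × Bool,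
    c * (signedSum f ⬝ᵥ signedSum f) ≤ signedSum f ⬝ᵥ A *ᵥ signedSum f

theorem IsGraphLasso.l1_sub_le {G : SimpleGraph (Fin n)} [DecidableRel G.Adj] {k : ℕ}
    {lam ν c C : ℝ} {X : Matrix (Fin N) (Fin n) ℝ} {βstar β : Fin n → ℝ} {ε : Fin N → ℝ}
    {s₁ s₂ R : ℕ}
    (hβ : IsGraphLasso G k (lam * √(ν / (2 * (G.maxDegree : ℝ)) ^ (k + 1))) lam X
      (response X βstar ε) β)
    (hN : 0 < N) (hd : 0 < G.maxDegree) (hlam : 0 < lam) (hν : 0 ≤ ν) (hs₂0 : 0 < s₂)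
    (hs₁ : l0 (diffOp G k *ᵥ βstar) ≤ s₁) (hs₂ : l0 βstar ≤ s₂) (hs : ν * s₁ ≤ s₂)
    (hnoise : ∀ j, |(Xᵀ *ᵥ ε) j| ≤ N * (lam / 2)) (hc : 0 < c) (hC : 0 ≤ C) (hR : 0 < R)
    (hRC : 72 * C ≤ c * R) (hX : IsSparselyConditioned (sampleGram X) c C (R * s₂ + 1)) :
    l1 (β - βstar) ≤ 72 * lam * s₂ / c := by
  obtain ⟨v, rfl⟩ : ∃ v, β = βstar + v := ⟨β - βstar, by abel⟩
  rw [add_sub_cancel_left]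
  have basic := lasso_basic_inequality hN hlam.le hν (by positivity)
    (diffOp_mulVec_dotProduct_self_le G · k) hs₁ hs₂ hs (hβ βstar) hnoise
  have lower := quadForm_lower_bound_of_forall_signedSum (sampleGram_isSymm X) hc.le hX.1
    (Nat.succ_pos _) hX.2 v
  have hq : 0 ≤ v ⬝ᵥ sampleGram X *ᵥ v := by
    rw [quadForm_sampleGram]
    positivity
  push_cast at lower
  rw [add_sub_cancel_right] at lower
  exact l1_le_of_basic_inequality hlam hc (Nat.cast_pos.2 hs₂0) (Nat.cast_pos.2 hR) hC hRC hq basic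
    lower

end ErrorBound

/-! ### A Bernstein inequality for squares of sub-Gaussian variables -/

section ExponentialMoments

theorem exp_mul_sub_one_sub_le {r w : ℝ} (hr : |r| ≤ 1) (hw : 0 ≤ w) :
    Real.exp (r * w) - 1 - r * w ≤ r ^ 2 * (Real.exp w - 1 - w) := by
  have series (x : ℝ) : HasSum (fun k : ℕ => x ^ (k + 2) / (k + 2).factorial)
      (Real.exp x - 1 - x) := by
    have exp_series := NormedSpace.expSeries_div_hasSum_exp (𝔸 := ℝ) x
    rw [← Real.exp_eq_exp_ℝ] at exp_series
    simpa [Finset.sum_range_succ, sub_sub] using (hasSum_nat_add_iff' 2).2 exp_series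
  refine hasSum_le (fun k => ?_) (series (r * w)) ((series w).mul_left (r ^ 2))
  have pow_le_one : r ^ k ≤ 1 :=
    (le_abs_self _).trans (by rw [abs_pow]; exact pow_le_one₀ (abs_nonneg _) hr)
  rw [mul_pow, mul_div_assoc, pow_add r k 2, mul_comm (r ^ k) (r ^ 2), mul_assoc]
  exact mul_le_mul_of_nonneg_left (mul_le_of_le_one_left (by positivity) pow_le_one) (sq_nonneg r)

theorem lintegral_exp_sq_div_four_gaussianReal_le :
    ∫⁻ g, ENNReal.ofReal (Real.exp (g ^ 2 / 4)) ∂gaussianReal 0 1 ≤ ENNReal.ofReal (3 / 2) := by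
  have tilted_density (g : ℝ) : gaussianPDF 0 1 g * ENNReal.ofReal (Real.exp (g ^ 2 / 4)) =
      ENNReal.ofReal ((√(2 * Real.pi))⁻¹ * Real.exp (-(1 / 4) * g ^ 2)) := by
    rw [gaussianPDF, ← ENNReal.ofReal_mul (gaussianPDFReal_nonneg _ _ _), gaussianPDFReal,
      mul_assoc, ← Real.exp_add, NNReal.coe_one, mul_one]
    ring_nf
  rw [gaussianReal_of_var_ne_zero _ one_ne_zero,
    lintegral_withDensity_eq_lintegral_mul _ (measurable_gaussianPDF _ _) (by fun_prop)]
  simp only [Pi.mul_apply, tilted_density]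
  rw [← ofReal_integral_eq_lintegral_ofReal
    ((integrable_exp_neg_mul_sq (by norm_num)).const_mul _)
    (Eventually.of_forall fun g => by positivity), integral_const_mul, integral_gaussian]
  refine ENNReal.ofReal_le_ofReal ?_
  rw [inv_mul_le_iff₀ (Real.sqrt_pos.2 (by positivity)), Real.sqrt_le_left (by positivity),
    mul_pow, Real.sq_sqrt (by positivity)]
  nlinarith [Real.pi_pos]

theorem lintegral_exp_mul_gaussianReal (v : NNReal) (s : ℝ) :
    ∫⁻ g, ENNReal.ofReal (Real.exp (s * g)) ∂gaussianReal 0 v =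
      ENNReal.ofReal (Real.exp (v * s ^ 2 / 2)) := by
  rw [← ofReal_integral_eq_lintegral_ofReal (integrable_exp_mul_gaussianReal _)
    (Eventually.of_forall fun g => by positivity)]
  simpa [mgf] using congrArg ENNReal.ofReal (congrFun (mgf_id_gaussianReal (μ := 0) (v := v)) s)

variable {Ω : Type*} [MeasurableSpace Ω] {P : Measure Ω} {Z : Ω → ℝ} {σ : ℝ}

-- Write `exp (z² / (4σ²)) = E exp (b z g)` with `g` standard normal and `b = 1 / (√2 σ)`, and
-- integrate over `z` before `g`.
theorem lintegral_exp_sq_le [SFinite P] (hZm : Measurable Z) (hσ : 0 < σ)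
    (hZ : HasSubgaussianMGF Z (σ ^ 2).toNNReal P) :
    ∫⁻ ω, ENNReal.ofReal (Real.exp (1 / (4 * σ ^ 2) * Z ω ^ 2)) ∂P ≤ ENNReal.ofReal (3 / 2) := by
  set b : ℝ := 1 / (√2 * σ) with hb
  have b_sq : b ^ 2 = 1 / (2 * σ ^ 2) := by
    rw [hb, div_pow, mul_pow, Real.sq_sqrt zero_le_two, one_pow]
  have decouple (z : ℝ) : ENNReal.ofReal (Real.exp (1 / (4 * σ ^ 2) * z ^ 2)) =
      ∫⁻ g, ENNReal.ofReal (Real.exp (b * z * g)) ∂gaussianReal 0 1 := by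
    rw [lintegral_exp_mul_gaussianReal, mul_pow, b_sq, NNReal.coe_one]
    ring_nf
  have inner_le (g : ℝ) : ∫⁻ ω, ENNReal.ofReal (Real.exp (b * Z ω * g)) ∂P ≤
      ENNReal.ofReal (Real.exp (g ^ 2 / 4)) := by
    simp_rw [mul_right_comm b _ g]
    rw [← ofReal_integral_eq_lintegral_ofReal (hZ.integrable_exp_mul _)
      (Eventually.of_forall fun g => by positivity)]
    refine ENNReal.ofReal_le_ofReal ((hZ.mgf_le (b * g)).trans_eq ?_)
    rw [Real.coe_toNNReal _ (sq_nonneg σ), mul_pow, b_sq]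
    congr 1
    field_simp
    ring
  simp_rw [decouple]
  rw [lintegral_lintegral_swap (by fun_prop)]
  exact (lintegral_mono inner_le).trans lintegral_exp_sq_div_four_gaussianReal_le

theorem integrable_exp_sq [SFinite P] (hZm : Measurable Z) (hσ : 0 < σ)
    (hZ : HasSubgaussianMGF Z (σ ^ 2).toNNReal P) :
    Integrable (fun ω => Real.exp (1 / (4 * σ ^ 2) * Z ω ^ 2)) P := by
  refine ⟨by fun_prop, ?_⟩
  rw [hasFiniteIntegral_iff_ofReal (Eventually.of_forall fun g => by positivity)]
  exact (lintegral_exp_sq_le hZm hσ hZ).trans_lt ENNReal.ofReal_lt_top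

theorem integral_exp_sq_le [SFinite P] (hZm : Measurable Z) (hσ : 0 < σ)
    (hZ : HasSubgaussianMGF Z (σ ^ 2).toNNReal P) :
    ∫ ω, Real.exp (1 / (4 * σ ^ 2) * Z ω ^ 2) ∂P ≤ 3 / 2 := by
  have lintegral_le := lintegral_exp_sq_le hZm hσ hZ
  rwa [← ofReal_integral_eq_lintegral_ofReal (integrable_exp_sq hZm hσ hZ)
    (Eventually.of_forall fun g => by positivity),
    ENNReal.ofReal_le_ofReal_iff (by norm_num)] at lintegral_le

end ExponentialMoments

section Chernoff

variable {Ω : Type*} [MeasurableSpace Ω] {P : Measure Ω} {Y : Ω → ℝ} {c s b : ℝ}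

theorem integrable_exp_mul_of_nonneg_of_le (hYm : Measurable Y) (hY0 : ∀ ω, 0 ≤ Y ω)
    (hY : Integrable (fun ω => Real.exp (c * Y ω)) P) (hs : s ≤ c) :
    Integrable (fun ω => Real.exp (s * Y ω)) P := by
  refine hY.mono' (by fun_prop) (Eventually.of_forall fun ω => ?_)
  rw [Real.norm_eq_abs, Real.abs_exp]
  exact Real.exp_le_exp.2 (mul_le_mul_of_nonneg_right hs (hY0 ω))

theorem integrable_of_integrable_exp_mul (hYm : Measurable Y) (hY0 : ∀ ω, 0 ≤ Y ω) (hc : 0 < c)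
    (hY : Integrable (fun ω => Real.exp (c * Y ω)) P) : Integrable Y P := by
  refine (hY.const_mul c⁻¹).mono' (by fun_prop) (Eventually.of_forall fun ω => ?_)
  rw [Real.norm_eq_abs, abs_of_nonneg (hY0 ω), ← div_eq_inv_mul, le_div_iff₀ hc]
  linarith [Real.add_one_le_exp (c * Y ω)]

theorem mul_integral_le_of_integral_exp_le [IsProbabilityMeasure P] (hYm : Measurable Y)
    (hY0 : ∀ ω, 0 ≤ Y ω) (hc : 0 < c) (hY : Integrable (fun ω => Real.exp (c * Y ω)) P)
    (hexp : ∫ ω, Real.exp (c * Y ω) ∂P ≤ 3 / 2) : c * ∫ ω, Y ω ∂P ≤ 1 / 2 := by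
  have hYi := integrable_of_integrable_exp_mul hYm hY0 hc hY
  have tangent_line := integral_mono ((hYi.const_mul c).add (integrable_const 1)) hY
    fun ω => Real.add_one_le_exp (c * Y ω)
  simp only [Pi.add_apply] at tangent_line
  rw [integral_add (hYi.const_mul c) (integrable_const 1), integral_const_mul, integral_const,
    probReal_univ, one_smul] at tangent_line
  linarith

theorem integral_exp_mul_le [IsProbabilityMeasure P] (hYm : Measurable Y) (hY0 : ∀ ω, 0 ≤ Y ω)
    (hc : 0 < c) (hY : Integrable (fun ω => Real.exp (c * Y ω)) P)
    (hexp : ∫ ω, Real.exp (c * Y ω) ∂P ≤ 3 / 2) (hs : |s| ≤ c) :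
    ∫ ω, Real.exp (s * Y ω) ∂P ≤ 1 + s * (∫ ω, Y ω ∂P) + s ^ 2 / (2 * c ^ 2) := by
  have hYi := integrable_of_integrable_exp_mul hYm hY0 hc hY
  have pointwise (ω : Ω) : Real.exp (s * Y ω) ≤
      1 + s * Y ω + (s / c) ^ 2 * (Real.exp (c * Y ω) - 1 - c * Y ω) := by
    have taylor := exp_mul_sub_one_sub_le (r := s / c) (w := c * Y ω)
      (by rw [abs_div, abs_of_pos hc]; exact (div_le_one hc).2 hs) (mul_nonneg hc.le (hY0 ω))
    rw [← mul_assoc, div_mul_cancel₀ s hc.ne'] at taylor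
    linarith
  have linear_part : Integrable (fun ω => 1 + s * Y ω) P :=
    (integrable_const _).add (hYi.const_mul s)
  have exp_sub_one : Integrable (fun ω => Real.exp (c * Y ω) - 1) P :=
    hY.sub (integrable_const _)
  have remainder_part : Integrable (fun ω => Real.exp (c * Y ω) - 1 - c * Y ω) P :=
    exp_sub_one.sub (hYi.const_mul c)
  have remainder_le : ∫ ω, Real.exp (c * Y ω) ∂P - 1 - c * ∫ ω, Y ω ∂P ≤ 1 / 2 := by
    have := mul_nonneg hc.le (integral_nonneg (μ := P) hY0)
    linarith
  calc ∫ ω, Real.exp (s * Y ω) ∂P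
    _ ≤ ∫ ω, (1 + s * Y ω + (s / c) ^ 2 * (Real.exp (c * Y ω) - 1 - c * Y ω)) ∂P :=
        integral_mono (integrable_exp_mul_of_nonneg_of_le hYm hY0 hY ((le_abs_self s).trans hs))
          (linear_part.add (remainder_part.const_mul _)) pointwise
    _ = 1 + s * (∫ ω, Y ω ∂P) +
          (s / c) ^ 2 * (∫ ω, Real.exp (c * Y ω) ∂P - 1 - c * ∫ ω, Y ω ∂P) := by
        rw [integral_add linear_part (remainder_part.const_mul _), integral_const_mul,
          integral_add (integrable_const _) (hYi.const_mul s),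
          integral_sub exp_sub_one (hYi.const_mul c), integral_sub hY (integrable_const _),
          integral_const_mul, integral_const_mul]
        simp only [integral_const, probReal_univ, one_smul]
    _ ≤ 1 + s * (∫ ω, Y ω ∂P) + (s / c) ^ 2 * (1 / 2) := by gcongr
    _ = 1 + s * (∫ ω, Y ω ∂P) + s ^ 2 / (2 * c ^ 2) := by ring

theorem mgf_le_exp_div [IsProbabilityMeasure P] (hYm : Measurable Y) (hY0 : ∀ ω, 0 ≤ Y ω)
    (hc : 0 < c) (hY : Integrable (fun ω => Real.exp (c * Y ω)) P)
    (hexp : ∫ ω, Real.exp (c * Y ω) ∂P ≤ 3 / 2) (hs : 0 ≤ s) (hsc : s ≤ c) :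
    mgf Y P s ≤ Real.exp (s / c) := by
  have ratio_nonneg : 0 ≤ s / c := by positivity
  have ratio_le_one : s / c ≤ 1 := (div_le_one hc).2 hsc
  have first_order : s * ∫ ω, Y ω ∂P ≤ s / c * (1 / 2) := by
    rw [← div_mul_cancel₀ s hc.ne', mul_assoc, div_mul_cancel₀ s hc.ne']
    gcongr
    exact mul_integral_le_of_integral_exp_le hYm hY0 hc hY hexp
  have second_order : s ^ 2 / (2 * c ^ 2) = (s / c) ^ 2 / 2 := by ring
  have integral_le := integral_exp_mul_le hYm hY0 hc hY hexp ((abs_of_nonneg hs).trans_le hsc)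
  rw [second_order] at integral_le
  rw [mgf]
  nlinarith [Real.add_one_le_exp (s / c)]

theorem mgf_sub_integral_le [IsProbabilityMeasure P] (hYm : Measurable Y) (hY0 : ∀ ω, 0 ≤ Y ω)
    (hc : 0 < c) (hY : Integrable (fun ω => Real.exp (c * Y ω)) P)
    (hexp : ∫ ω, Real.exp (c * Y ω) ∂P ≤ 3 / 2) (hs : |s| ≤ c) :
    mgf (fun ω => Y ω - ∫ ω, Y ω ∂P) P s ≤ Real.exp (s ^ 2 / (2 * c ^ 2)) := by
  have mgf_le : mgf Y P s ≤ Real.exp (s * (∫ ω, Y ω ∂P) + s ^ 2 / (2 * c ^ 2)) := by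
    refine (integral_exp_mul_le hYm hY0 hc hY hexp hs).trans ?_
    linarith [Real.add_one_le_exp (s * (∫ ω, Y ω ∂P) + s ^ 2 / (2 * c ^ 2))]
  simp only [sub_eq_add_neg]
  rw [mgf_add_const]
  refine (mul_le_mul_of_nonneg_right mgf_le (Real.exp_pos _).le).trans_eq ?_
  rw [← Real.exp_add]
  ring_nf

theorem measureReal_le_abs_le_of_mgf_le [IsFiniteMeasure P] (hs : 0 ≤ s)
    (hint : Integrable (fun ω => Real.exp (s * Y ω)) P)
    (hint_neg : Integrable (fun ω => Real.exp (-s * Y ω)) P)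
    (hmgf : mgf Y P s ≤ Real.exp b) (hmgf_neg : mgf Y P (-s) ≤ Real.exp b) (t : ℝ) :
    P.real {ω | t ≤ |Y ω|} ≤ 2 * Real.exp (b - s * t) := by
  have upper : P.real {ω | t ≤ Y ω} ≤ Real.exp (b - s * t) := by
    refine (measure_ge_le_exp_mul_mgf t hs hint).trans ?_
    rw [sub_eq_neg_add, Real.exp_add, neg_mul]
    gcongr
  have lower : P.real {ω | Y ω ≤ -t} ≤ Real.exp (b - s * t) := by
    refine (measure_le_le_exp_mul_mgf (-t) (neg_nonpos.2 hs) hint_neg).trans ?_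
    rw [sub_eq_neg_add, Real.exp_add, neg_neg, mul_neg]
    gcongr
  have cover : {ω | t ≤ |Y ω|} ⊆ {ω | t ≤ Y ω} ∪ {ω | Y ω ≤ -t} :=
    fun ω (hω : t ≤ |Y ω|) => (le_abs.1 hω).imp id le_neg_of_le_neg
  linarith [measureReal_mono (μ := P) cover,
    measureReal_union_le (μ := P) {ω | t ≤ Y ω} {ω | Y ω ≤ -t}]

theorem mgf_sum_le_of_iIndepFun {ι : Type*} [Fintype ι] {W : ι → Ω → ℝ} (hW : iIndepFun W P)
    (hWm : ∀ i, Measurable (W i)) (hmgf : ∀ i, mgf (W i) P s ≤ Real.exp b) :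
    mgf (fun ω => ∑ i, W i ω) P s ≤ Real.exp (Fintype.card ι * b) := by
  have sum_eq : (fun ω => ∑ i, W i ω) = ∑ i, W i := by
    ext ω
    rw [Finset.sum_apply]
  rw [sum_eq, hW.mgf_sum hWm, Real.exp_nat_mul, ← Finset.card_univ, ← Finset.prod_const]
  exact Finset.prod_le_prod (fun i _ => mgf_nonneg) fun i _ => hmgf i

theorem measureReal_abs_sum_sub_integral_ge_le [IsProbabilityMeasure P] {ι : Type*} [Fintype ι]
    {W : ι → Ω → ℝ} (hW : iIndepFun W P) (hWm : ∀ i, Measurable (W i)) (hW0 : ∀ i ω, 0 ≤ W i ω)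
    (hc : 0 < c) (hint : ∀ i, Integrable (fun ω => Real.exp (c * W i ω)) P)
    (hexp : ∀ i, ∫ ω, Real.exp (c * W i ω) ∂P ≤ 3 / 2) {t : ℝ} (ht : 0 ≤ t) (htc : c * t ≤ 1) :
    P.real {ω | Fintype.card ι * t ≤ |∑ i, (W i ω - ∫ ω, W i ω ∂P)|} ≤
      2 * Real.exp (-(Fintype.card ι * (c * t) ^ 2 / 2)) := by
  set V : ι → Ω → ℝ := fun i ω => W i ω - ∫ ω, W i ω ∂P with hV
  have hVm (i : ι) : Measurable (V i) := (hWm i).sub_const _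
  have hVind : iIndepFun V P :=
    hW.comp (fun i y => y - ∫ ω, W i ω ∂P) fun i => measurable_id.sub_const _
  set s := c ^ 2 * t with hs
  have abs_s : |s| ≤ c := by
    rw [abs_of_nonneg (by positivity)]
    nlinarith
  have hVint (i : ι) {r : ℝ} (hr : r ≤ c) : Integrable (fun ω => Real.exp (r * V i ω)) P := by
    simp only [hV, mul_sub, Real.exp_sub]
    exact (integrable_exp_mul_of_nonneg_of_le (hWm i) (hW0 i) (hint i) hr).div_const _
  have sum_integrable {r : ℝ} (hr : r ≤ c) :
      Integrable (fun ω => Real.exp (r * ∑ i, V i ω)) P := by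
    simpa only [Finset.sum_apply] using hVind.integrable_exp_mul_sum hVm fun i _ => hVint i hr
  have sum_mgf {r : ℝ} (hr : |r| ≤ c) : mgf (fun ω => ∑ i, V i ω) P r ≤
      Real.exp (Fintype.card ι * (r ^ 2 / (2 * c ^ 2))) :=
    mgf_sum_le_of_iIndepFun hVind hVm fun i =>
      mgf_sub_integral_le (hWm i) (hW0 i) hc (hint i) (hexp i) hr
  have tail := measureReal_le_abs_le_of_mgf_le (by positivity : 0 ≤ s)
    (sum_integrable ((le_abs_self s).trans abs_s)) (sum_integrable ((neg_le_abs s).trans abs_s))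
    (sum_mgf abs_s) ((sum_mgf ((abs_neg s).trans_le abs_s)).trans_eq (by rw [neg_sq]))
    (Fintype.card ι * t)
  refine tail.trans_eq ?_
  rw [hs]
  congr 2
  field_simp
  ring

end Chernoff

/-! ### Concentration for sub-Gaussian designs -/

theorem measurable_matrix_entry {m n : Type*} (i : m) (j : n) :
    Measurable fun x : Matrix m n ℝ => x i j :=
  (measurable_pi_apply j).comp (measurable_pi_apply (X := fun _ : m => n → ℝ) i)

section Design

variable {Ω : Type*} [MeasurableSpace Ω] {P : Measure Ω} {N n : ℕ}
  {X : Ω → Matrix (Fin N) (Fin n) ℝ} {σ : ℝ} {S : Matrix (Fin n) (Fin n) ℝ}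

theorem IsSubGaussianDesign.isSymm_cov (hX : IsSubGaussianDesign P X σ S) (hN : 0 < N) :
    S.IsSymm := by
  ext a b
  rw [transpose_apply, ← hX.cov ⟨0, hN⟩, ← hX.cov ⟨0, hN⟩, covariance_comm]

theorem IsSubGaussianDesign.measurable_dotProduct (hX : IsSubGaussianDesign P X σ S) (i : Fin N)
    (u : Fin n → ℝ) : Measurable fun ω => u ⬝ᵥ X ω i :=
  Finset.measurable_sum _ fun j _ =>
    ((measurable_matrix_entry i j).comp hX.measurable).const_mul _

theorem IsSubGaussianDesign.memLp_entry (hX : IsSubGaussianDesign P X σ S) (i : Fin N)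
    (j : Fin n) : MemLp (fun ω => X ω i j) 2 P := by
  simpa using (hX.subGaussian i (Pi.single j 1) (by simp)).2.memLp 2

theorem IsSubGaussianDesign.iIndepFun_sq (hX : IsSubGaussianDesign P X σ S) (u : Fin n → ℝ) :
    iIndepFun (fun (i : Fin N) ω => (u ⬝ᵥ X ω i) ^ 2) P :=
  hX.indep.comp (fun _ row => (u ⬝ᵥ row) ^ 2) fun _ => by
    simp only [dotProduct]
    fun_prop

theorem IsSubGaussianDesign.integral_sq [IsFiniteMeasure P] (hX : IsSubGaussianDesign P X σ S)
    (i : Fin N) (u : Fin n → ℝ) : ∫ ω, (u ⬝ᵥ X ω i) ^ 2 ∂P = u ⬝ᵥ S *ᵥ u := by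
  have hm (j : Fin n) : MemLp (fun ω => u j * X ω i j) 2 P := (hX.memLp_entry i j).const_mul _
  have centred : ∫ ω, u ⬝ᵥ X ω i ∂P = 0 := by
    simp only [dotProduct]
    rw [integral_finsetSum _ fun j _ => (hm j).integrable (by norm_num)]
    simp [integral_const_mul, hX.mean]
  calc ∫ ω, (u ⬝ᵥ X ω i) ^ 2 ∂P
    _ = cov[fun ω => u ⬝ᵥ X ω i, fun ω => u ⬝ᵥ X ω i; P] := by
        simp only [covariance, centred, sub_zero, sq]
    _ = ∑ a, ∑ b, u a * (u b * S a b) := by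
        refine (covariance_fun_sum_fun_sum hm hm).trans ?_
        simp_rw [covariance_const_mul_left, covariance_const_mul_right, hX.cov]
    _ = u ⬝ᵥ S *ᵥ u := by
        simp only [dotProduct, mulVec, Finset.mul_sum]
        exact Finset.sum_congr rfl fun a _ => Finset.sum_congr rfl fun b _ => by ring

variable [IsProbabilityMeasure P] {u : Fin n → ℝ}

theorem IsSubGaussianDesign.integrable_exp_sq (hX : IsSubGaussianDesign P X σ S) (hσ : 0 < σ)
    (hu : u ⬝ᵥ u = 1) (i : Fin N) :
    Integrable (fun ω => Real.exp (1 / (4 * σ ^ 2) * (u ⬝ᵥ X ω i) ^ 2)) P :=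
  GPPL.integrable_exp_sq (hX.measurable_dotProduct i u) hσ (hX.subGaussian i u hu).2

theorem IsSubGaussianDesign.integral_exp_sq_le (hX : IsSubGaussianDesign P X σ S) (hσ : 0 < σ)
    (hu : u ⬝ᵥ u = 1) (i : Fin N) :
    ∫ ω, Real.exp (1 / (4 * σ ^ 2) * (u ⬝ᵥ X ω i) ^ 2) ∂P ≤ 3 / 2 :=
  GPPL.integral_exp_sq_le (hX.measurable_dotProduct i u) hσ (hX.subGaussian i u hu).2

theorem IsSubGaussianDesign.cov_apply_self_le (hX : IsSubGaussianDesign P X σ S) (hσ : 0 < σ)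
    (hN : 0 < N) (j : Fin n) : S j j ≤ 2 * σ ^ 2 := by
  set u : Fin n → ℝ := Pi.single j 1
  have hu : u ⬝ᵥ u = 1 := by simp [u]
  have moment_le := mul_integral_le_of_integral_exp_le
    ((hX.measurable_dotProduct ⟨0, hN⟩ u).pow_const 2) (fun ω => sq_nonneg _) (by positivity)
    (hX.integrable_exp_sq hσ hu ⟨0, hN⟩) (hX.integral_exp_sq_le hσ hu ⟨0, hN⟩)
  rw [hX.integral_sq, div_mul_eq_mul_div, one_mul, div_le_iff₀ (by positivity)] at moment_le
  have quadForm_single : u ⬝ᵥ S *ᵥ u = S j j := by simp [u]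
  linarith

theorem IsSubGaussianDesign.measureReal_quadForm_unit_le (hX : IsSubGaussianDesign P X σ S)
    (hσ : 0 < σ) (hN : 0 < N) (hu : u ⬝ᵥ u = 1) {t : ℝ} (ht : 0 ≤ t) (htσ : t ≤ 4 * σ ^ 2) :
    P.real {ω | t ≤ |u ⬝ᵥ (sampleGram (X ω) - S) *ᵥ u|} ≤
      2 * Real.exp (-(N * t ^ 2 / (32 * σ ^ 4))) := by
  have hN' : (0 : ℝ) < N := Nat.cast_pos.2 hN
  have bernstein := measureReal_abs_sum_sub_integral_ge_le (hX.iIndepFun_sq u)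
    (fun i => (hX.measurable_dotProduct i u).pow_const 2) (fun i ω => sq_nonneg _)
    (by positivity) (hX.integrable_exp_sq hσ hu) (hX.integral_exp_sq_le hσ hu) ht
    (by rw [div_mul_eq_mul_div, one_mul]; exact (div_le_one (by positivity)).2 htσ)
  have centred_sum (ω : Ω) : ∑ i, ((u ⬝ᵥ X ω i) ^ 2 - ∫ ω, (u ⬝ᵥ X ω i) ^ 2 ∂P) =
      N * (u ⬝ᵥ (sampleGram (X ω) - S) *ᵥ u) := by
    simp_rw [hX.integral_sq]
    rw [sub_mulVec, dotProduct_sub, quadForm_sampleGram, Finset.sum_sub_distrib]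
    simp only [Finset.sum_const, Finset.card_univ, Fintype.card_fin, nsmul_eq_mul, mulVec,
      dotProduct_comm u]
    field_simp
  have event_eq : {ω | t ≤ |u ⬝ᵥ (sampleGram (X ω) - S) *ᵥ u|} =
      {ω | Fintype.card (Fin N) * t ≤
        |∑ i, ((u ⬝ᵥ X ω i) ^ 2 - ∫ ω, (u ⬝ᵥ X ω i) ^ 2 ∂P)|} := by
    simp_rw [centred_sum, abs_mul, abs_of_pos hN', Fintype.card_fin, mul_le_mul_iff_right₀ hN']
  rw [event_eq]
  refine bernstein.trans_eq ?_
  rw [Fintype.card_fin]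
  congr 3
  field_simp
  ring

theorem IsSubGaussianDesign.measureReal_quadForm_le (hX : IsSubGaussianDesign P X σ S)
    (hσ : 0 < σ) (hN : 0 < N) (u : Fin n → ℝ) {t : ℝ} (ht : 0 ≤ t) (htσ : t ≤ 4 * σ ^ 2) :
    P.real {ω | t * (u ⬝ᵥ u) < |u ⬝ᵥ (sampleGram (X ω) - S) *ᵥ u|} ≤
      2 * Real.exp (-(N * t ^ 2 / (32 * σ ^ 4))) := by
  rcases eq_or_ne u 0 with rfl | hu
  · simp only [zero_dotProduct, mul_zero, abs_zero, lt_irrefl, Set.ofPred_false,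
      measureReal_empty]
    positivity
  have hpos : 0 < u ⬝ᵥ u := by
    refine lt_of_le_of_ne (Finset.sum_nonneg fun i _ => mul_self_nonneg _) ?_
    exact fun h => hu (dotProduct_self_eq_zero.1 h.symm)
  set r := √(u ⬝ᵥ u)
  have r_mul_self : r * r = u ⬝ᵥ u := Real.mul_self_sqrt hpos.le
  have normalized : (r⁻¹ • u) ⬝ᵥ (r⁻¹ • u) = 1 := by
    rw [smul_dotProduct, dotProduct_smul, smul_eq_mul, smul_eq_mul, ← mul_assoc, ← mul_inv,
      r_mul_self, inv_mul_cancel₀ hpos.ne']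
  refine (measureReal_mono fun ω hω => ?_).trans
    (hX.measureReal_quadForm_unit_le hσ hN normalized ht htσ)
  rw [Set.mem_ofPred_eq] at hω ⊢
  simp only [mulVec_smul, smul_dotProduct, dotProduct_smul, smul_eq_mul]
  rw [← mul_assoc, abs_mul, ← mul_inv, r_mul_self, abs_of_pos (inv_pos.2 hpos),
    le_inv_mul_iff₀ hpos, mul_comm]
  exact hω.le

end Design

section Spectrum

variable {n : Type*} [Fintype n] [DecidableEq n] {S : Matrix n n ℝ} {a : ℝ}

theorem mul_dotProduct_self_le_of_spectrum (hS : S.IsSymm) (h : spectrum ℝ S ⊆ Set.Ici a)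
    (u : n → ℝ) : a * (u ⬝ᵥ u) ≤ u ⬝ᵥ S *ᵥ u := by
  have hermitian : S.IsHermitian := by rwa [IsHermitian, conjTranspose_eq_transpose_of_trivial]
  have shifted : (S - algebraMap ℝ _ a).PosSemidef := by
    rw [posSemidef_iff_isHermitian_and_spectrum_nonneg, ← spectrum.sub_singleton_eq]
    refine ⟨hermitian.sub (by simp [IsHermitian, algebraMap_eq_diagonal]), ?_⟩
    rintro _ ⟨x, hx, _, rfl, rfl⟩
    exact sub_nonneg.2 (Set.mem_Ici.1 (h hx))
  have nonneg := shifted.dotProduct_mulVec_nonneg u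
  rw [sub_mulVec, dotProduct_sub, Algebra.algebraMap_eq_smul_one, smul_mulVec, one_mulVec,
    dotProduct_smul, smul_eq_mul, star_trivial] at nonneg
  linarith

theorem isUnit_det_of_spectrum (ha : 0 < a) (h : spectrum ℝ S ⊆ Set.Ici a) : IsUnit S.det := by
  rw [← isUnit_iff_isUnit_det, ← spectrum.zero_notMem_iff ℝ]
  exact fun zero_mem => ha.not_ge (h zero_mem)

theorem row_inv_dotProduct_self_le (hS : S.IsSymm) (ha : 0 < a) (h : spectrum ℝ S ⊆ Set.Ici a)
    (i : n) : S⁻¹ i ⬝ᵥ S⁻¹ i ≤ 1 / a ^ 2 := by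
  set u := S⁻¹ i
  have row_eq : S *ᵥ u = Pi.single i 1 := by
    have vecMul_eq : S *ᵥ u = (S⁻¹ * S) i := by
      rw [mul_apply_eq_vecMul, ← mulVec_transpose, hS.eq]
    rw [vecMul_eq, nonsing_inv_mul _ (isUnit_det_of_spectrum ha h)]
    ext j
    simp [one_apply, Pi.single_apply, eq_comm]
  have coercive := mul_dotProduct_self_le_of_spectrum hS h u
  rw [row_eq, dotProduct_single, mul_one] at coercive
  have entry_sq_le : u i ^ 2 ≤ u ⬝ᵥ u := by
    rw [sq]
    exact Finset.single_le_sum (f := fun j => u j * u j) (fun j _ => mul_self_nonneg _)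
      (Finset.mem_univ i)
  have hnonneg : 0 ≤ u ⬝ᵥ u := (sq_nonneg _).trans entry_sq_le
  have sq_le : (a * (u ⬝ᵥ u)) ^ 2 ≤ u ⬝ᵥ u :=
    (pow_le_pow_left₀ (by positivity) coercive 2).trans entry_sq_le
  rw [le_div_iff₀ (by positivity)]
  rcases hnonneg.eq_or_lt with hzero | hpos
  · rw [← hzero, zero_mul]
    exact zero_le_one
  · refine le_of_mul_le_mul_left ?_ hpos
    linarith

end Spectrum

/-! ### The noise -/

theorem lintegral_exp_dotProduct_pi_gaussianReal {ι : Type*} [Fintype ι] (v : NNReal)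
    (u : ι → ℝ) :
    ∫⁻ e, ENNReal.ofReal (Real.exp (u ⬝ᵥ e)) ∂(Measure.pi fun _ : ι => gaussianReal 0 v) =
      ENNReal.ofReal (Real.exp (v / 2 * (u ⬝ᵥ u))) := by
  simp only [dotProduct, Real.exp_sum]
  rw [← ofReal_integral_eq_lintegral_ofReal
    (Integrable.fintype_prod (f := fun i e => Real.exp (u i * e))
      fun i => integrable_exp_mul_gaussianReal _) (Eventually.of_forall fun e => by positivity),
    integral_fintype_prod_eq_prod (fun i e => Real.exp (u i * e))]
  have factor (i : ι) : ∫ e, Real.exp (u i * e) ∂gaussianReal 0 v =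
      Real.exp (v / 2 * (u i * u i)) := by
    have mgf_eq := congrFun (mgf_id_gaussianReal (μ := 0) (v := v)) (u i)
    simp only [mgf, id, zero_mul, zero_add] at mgf_eq
    rw [mgf_eq]
    ring_nf
  simp_rw [factor]
  rw [← Real.exp_sum, Finset.mul_sum]

theorem lintegral_comp_prodMk_of_indepFun {Ω α β : Type*} [MeasurableSpace Ω] [MeasurableSpace α]
    [MeasurableSpace β] {P : Measure Ω} [IsFiniteMeasure P] {X : Ω → α} {Z : Ω → β}
    (hX : Measurable X) (hZ : AEMeasurable Z P) (hind : IndepFun X Z P) {F : α × β → ENNReal}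
    (hF : Measurable F) :
    ∫⁻ ω, F (X ω, Z ω) ∂P = ∫⁻ ω, ∫⁻ z, F (X ω, z) ∂(P.map Z) ∂P := by
  rw [← lintegral_map' hF.aemeasurable (hX.aemeasurable.prodMk hZ),
    (indepFun_iff_map_prod_eq_prod_map_map hX.aemeasurable hZ).1 hind,
    lintegral_prod _ hF.aemeasurable, lintegral_map hF.lintegral_prod_right' hX]

section Noise

variable {Ω : Type*} [MeasurableSpace Ω] {P : Measure Ω} [IsProbabilityMeasure P] {N n : ℕ}
  {X : Ω → Matrix (Fin N) (Fin n) ℝ} {σ : ℝ} {S : Matrix (Fin n) (Fin n) ℝ}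
  {ε : Ω → Fin N → ℝ} {τ s : ℝ} {u : Fin n → ℝ}

theorem IsSubGaussianDesign.lintegral_exp_mul_sum_sq_le (hX : IsSubGaussianDesign P X σ S)
    (hσ : 0 < σ) (hu : u ⬝ᵥ u = 1) (hs : 0 ≤ s) (hsσ : s ≤ 1 / (4 * σ ^ 2)) :
    ∫⁻ ω, ENNReal.ofReal (Real.exp (s * ∑ i, (u ⬝ᵥ X ω i) ^ 2)) ∂P ≤
      ENNReal.ofReal (Real.exp (N * (4 * σ ^ 2 * s))) := by
  have hm (i : Fin N) : Measurable fun ω => (u ⬝ᵥ X ω i) ^ 2 :=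
    (hX.measurable_dotProduct i u).pow_const 2
  have hc : 0 < 1 / (4 * σ ^ 2) := by positivity
  have hint := (hX.iIndepFun_sq u).integrable_exp_mul_sum hm (s := Finset.univ) fun i _ =>
    integrable_exp_mul_of_nonneg_of_le (hm i) (fun ω => sq_nonneg _)
      (hX.integrable_exp_sq hσ hu i) hsσ
  simp only [Finset.sum_apply] at hint
  rw [← ofReal_integral_eq_lintegral_ofReal hint (Eventually.of_forall fun e => by positivity)]
  refine ENNReal.ofReal_le_ofReal ((mgf_sum_le_of_iIndepFun (hX.iIndepFun_sq u) hm fun i =>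
    mgf_le_exp_div (hm i) (fun ω => sq_nonneg _) hc (hX.integrable_exp_sq hσ hu i)
      (hX.integral_exp_sq_le hσ hu i) hs hsσ).trans_eq ?_)
  rw [Fintype.card_fin, div_div_eq_mul_div, div_one, mul_comm s]

theorem IsSubGaussianDesign.lintegral_exp_mul_noise_le (hX : IsSubGaussianDesign P X σ S)
    (hσ : 0 < σ) (hε : HasLaw ε (Measure.pi fun _ => gaussianReal 0 (τ ^ 2).toNNReal) P)
    (hind : IndepFun X ε P) (hu : u ⬝ᵥ u = 1) (hs : τ ^ 2 / 2 * s ^ 2 ≤ 1 / (4 * σ ^ 2)) :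
    ∫⁻ ω, ENNReal.ofReal (Real.exp (s * ((X ω *ᵥ u) ⬝ᵥ ε ω))) ∂P ≤
      ENNReal.ofReal (Real.exp (N * (2 * σ ^ 2 * τ ^ 2 * s ^ 2))) := by
  have hF : Measurable fun p : Matrix (Fin N) (Fin n) ℝ × (Fin N → ℝ) =>
      ENNReal.ofReal (Real.exp (s * ((p.1 *ᵥ u) ⬝ᵥ p.2))) := by
    have : ∀ i j, Measurable fun p : Matrix (Fin N) (Fin n) ℝ × (Fin N → ℝ) => p.1 i j :=
      fun i j => (measurable_matrix_entry i j).comp measurable_fst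
    simp only [dotProduct, mulVec]
    fun_prop
  have integrate_noise (ω : Ω) :
      ∫⁻ e, ENNReal.ofReal (Real.exp (s * ((X ω *ᵥ u) ⬝ᵥ e))) ∂(P.map ε) =
        ENNReal.ofReal (Real.exp (τ ^ 2 / 2 * s ^ 2 * ∑ i, (u ⬝ᵥ X ω i) ^ 2)) := by
    have gaussian := lintegral_exp_dotProduct_pi_gaussianReal (τ ^ 2).toNNReal (s • X ω *ᵥ u)
    simp only [smul_dotProduct, dotProduct_smul, smul_eq_mul,
      Real.coe_toNNReal _ (sq_nonneg τ)] at gaussian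
    rw [hε.map_eq, gaussian]
    simp only [dotProduct_comm u, sq, mul_assoc]
    rfl
  rw [lintegral_comp_prodMk_of_indepFun (F := fun p => ENNReal.ofReal
    (Real.exp (s * ((p.1 *ᵥ u) ⬝ᵥ p.2)))) hX.measurable hε.aemeasurable hind hF]
  simp_rw [integrate_noise]
  refine (hX.lintegral_exp_mul_sum_sq_le hσ hu (by positivity) hs).trans_eq ?_
  ring_nf

theorem IsSubGaussianDesign.measureReal_noise_le (hX : IsSubGaussianDesign P X σ S) (hσ : 0 < σ)
    (hτ : 0 < τ) (hε : HasLaw ε (Measure.pi fun _ => gaussianReal 0 (τ ^ 2).toNNReal) P)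
    (hind : IndepFun X ε P) (hu : u ⬝ᵥ u = 1) {a : ℝ} (ha : 0 ≤ a) (haσ : a ^ 2 ≤ 8 * σ ^ 2) :
    P.real {ω | N * (τ * a) ≤ |(X ω *ᵥ u) ⬝ᵥ ε ω|} ≤
      2 * Real.exp (-(N * a ^ 2 / (8 * σ ^ 2))) := by
  set s := a / (4 * σ ^ 2 * τ) with hs
  have small : τ ^ 2 / 2 * s ^ 2 ≤ 1 / (4 * σ ^ 2) := by
    have value : τ ^ 2 / 2 * s ^ 2 = a ^ 2 / (32 * σ ^ 4) := by
      rw [hs]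
      field_simp
      ring
    rw [value, div_le_div_iff₀ (by positivity) (by positivity)]
    nlinarith [sq_nonneg σ]
  have measurable_score : AEMeasurable (fun ω => (X ω *ᵥ u) ⬝ᵥ ε ω) P := by
    refine Finset.aemeasurable_fun_sum _ fun i _ => AEMeasurable.mul ?_
      ((measurable_pi_apply i).comp_aemeasurable hε.aemeasurable)
    simp only [mulVec, dotProduct_comm _ u]
    exact (hX.measurable_dotProduct i u).aemeasurable
  have integrable_exp {r : ℝ} (hr : r ^ 2 = s ^ 2) :
      Integrable (fun ω => Real.exp (r * ((X ω *ᵥ u) ⬝ᵥ ε ω))) P := by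
    refine ⟨(Real.measurable_exp.comp_aemeasurable
      (measurable_score.const_mul r)).aestronglyMeasurable, ?_⟩
    rw [hasFiniteIntegral_iff_ofReal (Eventually.of_forall fun g => by positivity)]
    exact (hX.lintegral_exp_mul_noise_le hσ hε hind hu (by rwa [hr])).trans_lt
      ENNReal.ofReal_lt_top
  have mgf_le {r : ℝ} (hr : r ^ 2 = s ^ 2) : mgf (fun ω => (X ω *ᵥ u) ⬝ᵥ ε ω) P r ≤
      Real.exp (N * (2 * σ ^ 2 * τ ^ 2 * s ^ 2)) := by
    have lintegral_le := hX.lintegral_exp_mul_noise_le hσ hε hind hu (s := r) (by rwa [hr])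
    rwa [← ofReal_integral_eq_lintegral_ofReal (integrable_exp hr)
      (Eventually.of_forall fun g => by positivity),
      ENNReal.ofReal_le_ofReal_iff (by positivity), hr] at lintegral_le
  refine (measureReal_le_abs_le_of_mgf_le (by positivity : 0 ≤ s) (integrable_exp rfl)
    (integrable_exp (neg_sq s)) (mgf_le rfl) (mgf_le (neg_sq s)) _).trans_eq ?_
  rw [hs]
  congr 2
  field_simp
  ring

end Noise

/-! ### The conditional law of the noise term -/

section CondDistrib

variable {Ω α β γ : Type*} [MeasurableSpace Ω] [MeasurableSpace α] [MeasurableSpace β]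
  [MeasurableSpace γ] {P : Measure Ω} [IsProbabilityMeasure P] {X : Ω → α} {Z : Ω → β}
  {F : α × β → γ}

theorem map_id_prod_const_apply (hF : Measurable F) (ρ : Measure β) [SFinite ρ] (x : α) :
    (Kernel.id ×ₖ Kernel.const α ρ).map F x = ρ.map fun z => F (x, z) := by
  rw [Kernel.map_apply _ hF, Kernel.prod_apply, Kernel.id_apply, Kernel.const_apply,
    Measure.dirac_prod, Measure.map_map hF measurable_prodMk_left]
  rfl

theorem map_prodMk_comp_eq_compProd_of_indepFun (hX : Measurable X) (hZ : AEMeasurable Z P)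
    (hind : IndepFun X Z P) (hF : Measurable F) :
    P.map (fun ω => (X ω, F (X ω, Z ω))) =
      P.map X ⊗ₘ (Kernel.id ×ₖ Kernel.const α (P.map Z)).map F := by
  have hG : Measurable fun p : α × β => (p.1, F p) := measurable_fst.prodMk hF
  have map_eq : P.map (fun ω => (X ω, F (X ω, Z ω))) =
      ((P.map X).prod (P.map Z)).map fun p => (p.1, F p) := by
    rw [← (indepFun_iff_map_prod_eq_prod_map_map hX.aemeasurable hZ).1 hind,
      AEMeasurable.map_map_of_aemeasurable hG.aemeasurable (hX.aemeasurable.prodMk hZ)]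
    rfl
  have := Measure.isProbabilityMeasure_map hX.aemeasurable (μ := P)
  have := Measure.isProbabilityMeasure_map hZ
  have : IsMarkovKernel ((Kernel.id ×ₖ Kernel.const α (P.map Z)).map F) :=
    Kernel.IsMarkovKernel.map _ hF
  ext s hs
  rw [map_eq, Measure.map_apply hG hs, Measure.prod_apply (hG hs), Measure.compProd_apply hs]
  refine lintegral_congr fun x => ?_
  have hFx : Measurable fun z => F (x, z) := hF.comp measurable_prodMk_left
  rw [map_id_prod_const_apply hF, Measure.map_apply hFx (measurable_prodMk_left hs)]
  rfl

theorem condDistrib_comp_of_indepFun [StandardBorelSpace γ] [Nonempty γ] (hX : Measurable X)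
    (hZ : AEMeasurable Z P) (hind : IndepFun X Z P) (hF : Measurable F) :
    ∀ᵐ x ∂(P.map X), condDistrib (fun ω => F (X ω, Z ω)) X P x =
      (P.map Z).map fun z => F (x, z) := by
  have := Measure.isProbabilityMeasure_map hZ
  have : IsMarkovKernel ((Kernel.id ×ₖ Kernel.const α (P.map Z)).map F) :=
    Kernel.IsMarkovKernel.map _ hF
  filter_upwards [condDistrib_ae_eq_of_measure_eq_compProd X
    (hF.comp_aemeasurable (hX.aemeasurable.prodMk hZ))
    (map_prodMk_comp_eq_compProd_of_indepFun hX hZ hind hF)] with x hx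
  exact hx.trans (map_id_prod_const_apply hF _ x)

end CondDistrib

section Gaussian

variable {m p : Type*} [Fintype p]

theorem measurable_toLp_mulVec (A : Matrix m p ℝ) :
    Measurable fun e : p → ℝ => WithLp.toLp 2 (A *ᵥ e) := by
  refine (WithLp.measurable_toLp 2 (m → ℝ)).comp (measurable_pi_lambda _ fun i => ?_)
  simp only [mulVec, dotProduct]
  fun_prop

variable [Fintype m]

theorem dotProduct_smul_mul_transpose_mulVec (A : Matrix m p ℝ) (c : ℝ) (u : m → ℝ) :
    u ⬝ᵥ (c • (A * Aᵀ)) *ᵥ u = c * ∑ i, (Aᵀ *ᵥ u) i ^ 2 := by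
  rw [smul_mulVec, dotProduct_smul, ← mulVec_mulVec, dotProduct_mulVec, ← mulVec_transpose,
    smul_eq_mul]
  simp only [dotProduct, sq]

theorem charFun_map_mulVec (A : Matrix m p ℝ) (ρ : Measure (p → ℝ)) (t : EuclideanSpace ℝ m) :
    charFun (ρ.map fun e => WithLp.toLp 2 (A *ᵥ e)) t =
      charFun (ρ.map (WithLp.toLp 2)) (WithLp.toLp 2 (Aᵀ *ᵥ t.ofLp)) := by
  rw [charFun_apply, charFun_apply,
    integral_map (measurable_toLp_mulVec A).aemeasurable (by fun_prop),
    integral_map (by fun_prop) (by fun_prop)]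
  refine integral_congr_ae (Eventually.of_forall fun e => ?_)
  simp only [EuclideanSpace.inner_eq_star_dotProduct, star_trivial]
  rw [dotProduct_mulVec, ← mulVec_transpose]

theorem map_mulVec_pi_gaussianReal [DecidableEq m] (A : Matrix m p ℝ) (τ : ℝ) :
    (Measure.pi fun _ : p => gaussianReal 0 (τ ^ 2).toNNReal).map
        (fun e => WithLp.toLp 2 (A *ᵥ e)) =
      multivariateGaussian 0 (τ ^ 2 • (A * Aᵀ)) := by
  have posSemidef : (τ ^ 2 • (A * Aᵀ)).PosSemidef := by
    have := (posSemidef_self_mul_conjTranspose A).smul (sq_nonneg τ)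
    rwa [conjTranspose_eq_transpose_of_trivial] at this
  have := Measure.isProbabilityMeasure_map (measurable_toLp_mulVec A).aemeasurable
    (μ := Measure.pi fun _ : p => gaussianReal 0 (τ ^ 2).toNNReal)
  refine Measure.ext_of_charFun (E := EuclideanSpace ℝ m) (funext fun t => ?_)
  rw [charFun_multivariateGaussian posSemidef, charFun_map_mulVec, charFun_pi]
  simp_rw [charFun_gaussianReal]
  rw [← Complex.exp_sum, dotProduct_smul_mul_transpose_mulVec]
  congr 1
  simp only [inner_zero_right, Complex.ofReal_zero, zero_mul, mul_zero, zero_sub,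
    Real.coe_toNNReal _ (sq_nonneg τ)]
  push_cast
  rw [Finset.mul_sum, Finset.sum_div, ← Finset.sum_neg_distrib]

end Gaussian

section NoiseTerm

variable {N n : ℕ} {m : Type*}

theorem noiseTerm_eq_mulVec (D : Matrix m (Fin n) ℝ) (Θ : Matrix (Fin n) (Fin n) ℝ)
    (X : Matrix (Fin N) (Fin n) ℝ) (e : Fin N → ℝ) :
    noiseTerm D Θ X e = ((1 / √(N : ℝ)) • (D * Θ * Xᵀ)) *ᵥ e := by
  rw [noiseTerm, smul_mulVec]

theorem sandwich_eq_mul_transpose (D : Matrix m (Fin n) ℝ) (Θ : Matrix (Fin n) (Fin n) ℝ)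
    (X : Matrix (Fin N) (Fin n) ℝ) :
    sandwich D Θ X =
      ((1 / √(N : ℝ)) • (D * Θ * Xᵀ)) * ((1 / √(N : ℝ)) • (D * Θ * Xᵀ))ᵀ := by
  have scale : (1 / √(N : ℝ)) * (1 / √(N : ℝ)) = 1 / N := by
    rw [div_mul_div_comm, one_mul, Real.mul_self_sqrt N.cast_nonneg]
  simp only [sandwich, sampleGram, transpose_smul, transpose_mul, transpose_transpose,
    Matrix.smul_mul, Matrix.mul_smul, smul_smul, scale, Matrix.mul_assoc]

theorem measurable_noiseTerm (D : Matrix m (Fin n) ℝ)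
    {Θhat : Matrix (Fin N) (Fin n) ℝ → Matrix (Fin n) (Fin n) ℝ} (hΘ : Measurable Θhat) :
    Measurable fun p : Matrix (Fin N) (Fin n) ℝ × (Fin N → ℝ) =>
      WithLp.toLp 2 (noiseTerm D (Θhat p.1) p.1 p.2) := by
  refine (WithLp.measurable_toLp 2 (m → ℝ)).comp (measurable_pi_lambda _ fun i => ?_)
  have entry (a b) : Measurable fun p : Matrix (Fin N) (Fin n) ℝ × (Fin N → ℝ) => p.1 a b :=
    (measurable_matrix_entry a b).comp measurable_fst
  have estimate (a b) :
      Measurable fun p : Matrix (Fin N) (Fin n) ℝ × (Fin N → ℝ) => Θhat p.1 a b :=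
    (measurable_matrix_entry a b).comp (hΘ.comp measurable_fst)
  simp only [noiseTerm, Pi.smul_apply, smul_eq_mul, mulVec, dotProduct, mul_apply, transpose_apply]
  exact (Finset.measurable_fun_sum _ fun a _ => (Finset.measurable_fun_sum _ fun b _ =>
    (Finset.measurable_fun_sum _ fun c _ => (estimate c b).const_mul _).mul (entry a b)).mul
      ((measurable_pi_apply a).comp measurable_snd)).const_mul _

theorem condDistrib_noiseTerm [Fintype m] [DecidableEq m] {Ω : Type*} [MeasurableSpace Ω]
    {P : Measure Ω} [IsProbabilityMeasure P] {X : Ω → Matrix (Fin N) (Fin n) ℝ}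
    {ε : Ω → Fin N → ℝ} {τ : ℝ} (hX : Measurable X)
    (hε : HasLaw ε (Measure.pi fun _ => gaussianReal 0 (τ ^ 2).toNNReal) P)
    (hind : IndepFun X ε P) (D : Matrix m (Fin n) ℝ)
    {Θhat : Matrix (Fin N) (Fin n) ℝ → Matrix (Fin n) (Fin n) ℝ} (hΘ : Measurable Θhat) :
    ∀ᵐ x ∂(P.map X),
      condDistrib (fun ω => WithLp.toLp 2 (noiseTerm D (Θhat (X ω)) (X ω) (ε ω))) X P x =
        multivariateGaussian 0 (τ ^ 2 • sandwich D (Θhat x) x) := by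
  filter_upwards [condDistrib_comp_of_indepFun hX hε.aemeasurable hind
    (measurable_noiseTerm D hΘ)] with x hx
  rw [hx, hε.map_eq, sandwich_eq_mul_transpose, ← map_mulVec_pi_gaussianReal]
  simp_rw [noiseTerm_eq_mulVec]

end NoiseTerm

/-! ### Union bounds -/

theorem measureReal_exists_le {Ω ι : Type*} [MeasurableSpace Ω] {P : Measure Ω} [Fintype ι]
    {p : ι → Ω → Prop} {B : ℝ} (h : ∀ i, P.real {ω | p i ω} ≤ B) :
    P.real {ω | ∃ i, p i ω} ≤ Fintype.card ι * B := by
  rw [Set.ofPred_exists]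
  refine (measureReal_iUnion_fintype_le _).trans ((Finset.sum_le_sum fun i _ => h i).trans_eq ?_)
  rw [Finset.sum_const, nsmul_eq_mul, Finset.card_univ]

theorem natCast_pow_mul_exp_neg_le {n a : ℕ} (hn : 0 < n) {x : ℝ}
    (hx : (a + 1) * Real.log n ≤ x) : (n : ℝ) ^ a * Real.exp (-x) ≤ 1 / n := by
  have hn' : (0 : ℝ) < n := Nat.cast_pos.2 hn
  calc (n : ℝ) ^ a * Real.exp (-x)
    _ ≤ (n : ℝ) ^ a * Real.exp (-((a + 1 : ℕ) * Real.log n)) := by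
        push_cast
        gcongr
    _ = 1 / n := by
        rw [Real.exp_neg, ← Real.log_pow, Real.exp_log (pow_pos hn' _), pow_succ]
        field_simp

theorem measureReal_exists_le_div {Ω ι : Type*} [MeasurableSpace Ω] {P : Measure Ω} [Fintype ι]
    {p : ι → Ω → Prop} {n a : ℕ} {x C : ℝ} (hn : 0 < n) (hC : 0 ≤ C)
    (hcard : (Fintype.card ι : ℝ) ≤ C * n ^ a) (hx : (a + 1) * Real.log n ≤ x)
    (h : ∀ i, P.real {ω | p i ω} ≤ 2 * Real.exp (-x)) : P.real {ω | ∃ i, p i ω} ≤ 2 * C / n :=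
  calc P.real {ω | ∃ i, p i ω}
    _ ≤ Fintype.card ι * (2 * Real.exp (-x)) := measureReal_exists_le h
    _ ≤ C * n ^ a * (2 * Real.exp (-x)) := by gcongr
    _ = 2 * C * ((n : ℝ) ^ a * Real.exp (-x)) := by ring
    _ ≤ 2 * C * (1 / n) := by gcongr; exact natCast_pow_mul_exp_neg_le hn hx
    _ = 2 * C / n := by ring

theorem natCast_mul_mul_sqrt_sq {N : ℕ} (hN : 0 < N) (n : ℕ) (c : ℝ) :
    N * (c * √(Real.log n / N)) ^ 2 = c ^ 2 * Real.log n := by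
  have hN' : (0 : ℝ) < N := Nat.cast_pos.2 hN
  rw [mul_pow, Real.sq_sqrt (div_nonneg (Real.log_natCast_nonneg n) hN'.le)]
  field_simp

/-! ### Exceptional events -/

/-- The lower bound for `λ / (σ_ε √(log n / N))`: it makes `N λ / 2` exceed the largest
correlation of a column of the design with the noise. -/
noncomputable def lamConst (σ : ℝ) : ℝ := 8 * σ

/-- The lower bound for `μ / √(log n / N)`: it makes the inverse covariance matrix feasible for
the CLIME program when `a` bounds the eigenvalues of the covariance matrix from below. The
summand `5 / 2` forces the deviations considered into the Gaussian range of Bernstein's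
inequality whenever `μ < 1`. -/
noncomputable def climeConst (σ a : ℝ) : ℝ := 5 * σ ^ 2 * (1 + 1 / a ^ 2) + 5 / 2

section Events

variable {N n : ℕ} {σ a t : ℝ} {S : Matrix (Fin n) (Fin n) ℝ}

theorem climeFeasible_inv_of_forall (hS : S.IsSymm) (ha : 0 < a) (hsp : spectrum ℝ S ⊆ Set.Ici a)
    {A : Matrix (Fin n) (Fin n) ℝ} (hA : A.IsSymm) (ht : 0 ≤ t)
    (h : ∀ p : Fin n × Fin n × Bool, |(S⁻¹ p.1 + signedBasis p.2) ⬝ᵥ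
      (A - S) *ᵥ (S⁻¹ p.1 + signedBasis p.2)| ≤
        t * ((S⁻¹ p.1 + signedBasis p.2) ⬝ᵥ (S⁻¹ p.1 + signedBasis p.2))) :
    ClimeFeasible A (t / 2 * (1 + 1 / a ^ 2)) S⁻¹ := by
  refine matMax_le (by positivity) fun i j => ?_
  have entry_eq : (S⁻¹ * A - 1) i j = S⁻¹ i ⬝ᵥ (A - S) *ᵥ (Pi.single j 1) := by
    rw [← nonsing_inv_mul _ (isUnit_det_of_spectrum ha hsp), ← Matrix.mul_sub, mulVec_single_one]
    rfl
  have hplus := h (i, j, true)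
  have hminus := h (i, j, false)
  simp only [signedBasis, if_true, Bool.false_eq_true, if_false, Pi.single_neg,
    ← sub_eq_add_neg] at hplus hminus
  calc |(S⁻¹ * A - 1) i j|
    _ ≤ t / 2 * (S⁻¹ i ⬝ᵥ S⁻¹ i + Pi.single j 1 ⬝ᵥ Pi.single j 1) := by
        rw [entry_eq]
        exact abs_dotProduct_mulVec_le_of_add_sub (hA.sub hS) hplus hminus
    _ ≤ t / 2 * (1 / a ^ 2 + 1) := by
        rw [single_dotProduct, Pi.single_eq_same, one_mul]
        gcongr
        exact row_inv_dotProduct_self_le hS ha hsp i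
    _ = t / 2 * (1 + 1 / a ^ 2) := by rw [add_comm]

theorem isSparselyConditioned_of_forall (hS : S.IsSymm) (hsp : spectrum ℝ S ⊆ Set.Ici a)
    {A : Matrix (Fin n) (Fin n) ℝ} {m : ℕ} {b b' : ℝ} (hta : t ≤ a / 2) (hb : ∀ j, S j j ≤ b)
    (hdiag : ∀ j, |Pi.single j 1 ⬝ᵥ (A - S) *ᵥ Pi.single j 1| ≤
      b' * ((Pi.single j 1 : Fin n → ℝ) ⬝ᵥ Pi.single j 1))
    (hsum : ∀ f : Fin m → Fin n × Bool, |signedSum f ⬝ᵥ (A - S) *ᵥ signedSum f| ≤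
      t * (signedSum f ⬝ᵥ signedSum f)) :
    IsSparselyConditioned A (a / 2) (b + b') m := by
  refine ⟨fun j => ?_, fun f => ?_⟩
  · have deviation := (le_abs_self _).trans (hdiag j)
    simp only [single_dotProduct, mulVec_single, Pi.single_eq_same, one_mul, mul_one,
      MulOpposite.op_one, one_smul, col_apply, Matrix.sub_apply] at deviation
    linarith [hb j]
  · have deviation := (neg_le_abs _).trans (hsum f)
    have coercive := mul_dotProduct_self_le_of_spectrum hS hsp (signedSum f)
    have small : t * (signedSum f ⬝ᵥ signedSum f) ≤ a / 2 * (signedSum f ⬝ᵥ signedSum f) :=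
      mul_le_mul_of_nonneg_right hta (Finset.sum_nonneg fun i _ => mul_self_nonneg _)
    rw [sub_mulVec, dotProduct_sub] at deviation
    linarith

variable {Ω : Type*} [MeasurableSpace Ω] {P : Measure Ω} [IsProbabilityMeasure P]
  {X : Ω → Matrix (Fin N) (Fin n) ℝ}

theorem IsSubGaussianDesign.measureReal_exists_quadForm_le {ι : Type*} [Fintype ι]
    (hX : IsSubGaussianDesign P X σ S) (hσ : 0 < σ) (hN : 0 < N) (hn : 0 < n)
    (w : ι → Fin n → ℝ) (ht : 0 ≤ t) (htσ : t ≤ 4 * σ ^ 2) {C : ℝ} {d : ℕ} (hC : 0 ≤ C)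
    (hcard : (Fintype.card ι : ℝ) ≤ C * n ^ d)
    (hNn : (d + 1) * Real.log n ≤ N * t ^ 2 / (32 * σ ^ 4)) :
    P.real {ω | ∃ i, t * (w i ⬝ᵥ w i) < |w i ⬝ᵥ (sampleGram (X ω) - S) *ᵥ w i|} ≤ 2 * C / n :=
  measureReal_exists_le_div hn hC hcard hNn fun i => hX.measureReal_quadForm_le hσ hN (w i) ht htσ

theorem IsSubGaussianDesign.measureReal_not_climeFeasible_le (hX : IsSubGaussianDesign P X σ S)
    (hσ : 0 < σ) (hN : 0 < N) (hn : 0 < n) (ha : 0 < a) (hsp : spectrum ℝ S ⊆ Set.Ici a) {μ : ℝ}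
    (hμ : climeConst σ a * √(Real.log n / N) ≤ μ) :
    P.real {ω | ¬ (1 ≤ μ ∨ ClimeFeasible (sampleGram (X ω)) μ S⁻¹)} ≤ 4 / n := by
  rcases le_or_gt 1 μ with hμ1 | hμ1
  · simp only [hμ1, true_or, not_true_eq_false, Set.ofPred_false, measureReal_empty]
    positivity
  set ρ := √(Real.log n / N)
  rw [climeConst, add_mul] at hμ
  have hrow : 0 ≤ 5 * σ ^ 2 * (1 + 1 / a ^ 2) * ρ := by positivity
  have ht : 0 ≤ 10 * σ ^ 2 * ρ := by positivity
  have htσ : 10 * σ ^ 2 * ρ ≤ 4 * σ ^ 2 := by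
    have : 5 / 2 * ρ ≤ 1 := by linarith
    nlinarith [sq_nonneg σ]
  have deviations := hX.measureReal_exists_quadForm_le hσ hN hn (t := 10 * σ ^ 2 * ρ) (C := 2)
    (d := 2) (fun p : Fin n × Fin n × Bool => S⁻¹ p.1 + signedBasis p.2) ht htσ two_pos.le
    (by simp only [Fintype.card_prod, Fintype.card_fin, Fintype.card_bool]; push_cast; linarith)
    (by
      rw [natCast_mul_mul_sqrt_sq hN, le_div_iff₀ (by positivity)]
      have : 0 ≤ σ ^ 4 * Real.log n := mul_nonneg (by positivity) (Real.log_natCast_nonneg n)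
      push_cast
      linarith)
  refine (measureReal_mono fun ω hω => ?_).trans (deviations.trans_eq (by norm_num))
  rw [Set.mem_ofPred_eq] at hω ⊢
  contrapose! hω
  refine Or.inr ((climeFeasible_inv_of_forall (hX.isSymm_cov hN) ha hsp (sampleGram_isSymm _) ht
    hω).trans ?_)
  have : 0 ≤ 5 / 2 * ρ := by positivity
  linarith

theorem IsSubGaussianDesign.measureReal_not_isSparselyConditioned_le
    (hX : IsSubGaussianDesign P X σ S) (hσ : 0 < σ) (hN : 0 < N) (hn : 2 ≤ n)
    (hsp : spectrum ℝ S ⊆ Set.Ici a) {m : ℕ} (hm : 0 < m) (ht : 0 ≤ t) (hta : t ≤ a / 2)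
    (htσ : t ≤ 4 * σ ^ 2) (hNn : (2 * m + 1) * Real.log n ≤ N * t ^ 2 / (32 * σ ^ 4)) :
    P.real {ω | ¬ IsSparselyConditioned (sampleGram (X ω)) (a / 2) (2 * σ ^ 2 + 4 * σ ^ 2) m} ≤
      4 / n := by
  have := Real.log_natCast_nonneg n
  have diagonal := hX.measureReal_exists_quadForm_le hσ hN (by omega) (t := 4 * σ ^ 2) (C := 1)
    (d := 1) (fun j : Fin n => Pi.single j 1) (by positivity) le_rfl zero_le_one (by simp) (by
      refine le_trans ?_ (hNn.trans (by gcongr))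
      have : (1 : ℝ) ≤ m := Nat.one_le_cast.2 hm
      push_cast
      gcongr
      linarith)
  have sums := hX.measureReal_exists_quadForm_le hσ hN (by omega) (C := 1) (d := 2 * m)
    (fun f : Fin m → Fin n × Bool => signedSum f) ht htσ zero_le_one (by
      rw [one_mul, pow_mul]
      simp only [Fintype.card_pi, Fintype.card_prod, Fintype.card_fin, Fintype.card_bool,
        Finset.prod_const, Finset.card_univ, Nat.cast_pow]
      push_cast
      gcongr
      rw [sq]
      gcongr
      exact_mod_cast hn) (by push_cast; exact hNn)
  refine (measureReal_mono fun ω hω => ?_).trans ((measureReal_union_le _ _).trans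
    ((add_le_add diagonal sums).trans_eq (by ring)))
  rw [Set.mem_union, Set.mem_ofPred_eq, Set.mem_ofPred_eq]
  rw [Set.mem_ofPred_eq] at hω
  contrapose! hω
  exact isSparselyConditioned_of_forall (hX.isSymm_cov hN) hsp hta (hX.cov_apply_self_le hσ hN)
    hω.1 hω.2

theorem IsSubGaussianDesign.measureReal_exists_noise_le (hX : IsSubGaussianDesign P X σ S)
    (hσ : 0 < σ) (hN : 0 < N) (hn : 0 < n) {ε : Ω → Fin N → ℝ} {τ : ℝ} (hτ : 0 < τ)
    (hε : HasLaw ε (Measure.pi fun _ => gaussianReal 0 (τ ^ 2).toNNReal) P)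
    (hind : IndepFun X ε P) {lam : ℝ} (hlam : lamConst σ * (τ * √(Real.log n / N)) ≤ lam)
    (hNn : 2 * Real.log n ≤ N) :
    P.real {ω | ∃ j, N * (lam / 2) < |((X ω)ᵀ *ᵥ ε ω) j|} ≤ 2 / n := by
  have hN' : (0 : ℝ) < N := Nat.cast_pos.2 hN
  set r := 4 * σ * √(Real.log n / N) with hr
  have natCast_mul_sq : N * r ^ 2 = 16 * σ ^ 2 * Real.log n := by
    rw [hr, natCast_mul_mul_sqrt_sq hN]
    ring
  have hrσ : r ^ 2 ≤ 8 * σ ^ 2 := by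
    refine le_of_mul_le_mul_left ?_ hN'
    rw [natCast_mul_sq]
    nlinarith [sq_nonneg σ]
  have hunit (j : Fin n) : (Pi.single j 1 : Fin n → ℝ) ⬝ᵥ Pi.single j 1 = 1 := by simp
  have score_le := measureReal_exists_le_div (P := P) (a := 1) (C := 1) (ι := Fin n) hn zero_le_one
    (by simp) (by
      rw [natCast_mul_sq]
      refine le_of_eq ?_
      field_simp
      push_cast
      ring)
    fun j => hX.measureReal_noise_le hσ hτ hε hind (hunit j) (by positivity) hrσ
  refine (measureReal_mono fun ω hω => ?_).trans (score_le.trans_eq (by norm_num))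
  rw [Set.mem_ofPred_eq] at hω ⊢
  obtain ⟨j, hj⟩ := hω
  refine ⟨j, le_trans ?_ (hj.le.trans_eq ?_)⟩
  · rw [lamConst] at hlam
    gcongr
    linarith
  · rw [mulVec_single_one]
    rfl

end Events

/-! ### Rates -/

theorem one_lt_of_maxDegree_pos {n : ℕ} {G : SimpleGraph (Fin n)} [DecidableRel G.Adj]
    (h : 0 < G.maxDegree) : 1 < n := by
  have : Nonempty (Fin n) := by
    by_contra hn
    rw [not_nonempty_iff] at hn
    exact h.ne' G.maxDegree_of_subsingleton
  simpa only [Fintype.card_fin] using (Nat.succ_le_of_lt h).trans_lt G.maxDegree_lt_card_verts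

theorem sqrt_log_div_pos {n N : ℕ} (hn : 1 < n) (hN : 0 < N) : 0 < √(Real.log n / N) :=
  Real.sqrt_pos.2 (div_pos (Real.log_pos (Nat.one_lt_cast.2 hn)) (Nat.cast_pos.2 hN))

theorem rpow_natCast_add_one_div_two {x : ℝ} (hx : 0 ≤ x) (k : ℕ) :
    x ^ (((k : ℝ) + 1) / 2) = √(x ^ (k + 1)) := by
  rw [Real.rpow_div_two_eq_sqrt _ hx, ← Nat.cast_add_one, Real.rpow_natCast, eq_comm,
    Real.sqrt_eq_iff_mul_self_eq (by positivity) (by positivity), ← mul_pow,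
    Real.mul_self_sqrt hx]

theorem sqrt_mul_sqrt_div_sq {x y : ℝ} (hx : 0 ≤ x) (hy : 0 ≤ y) :
    √y * √(x / y) ^ 2 = x / √y := by
  rw [Real.sq_sqrt (div_nonneg hx hy), mul_div_left_comm, Real.sqrt_div_self, div_eq_mul_inv]

theorem isBigOInProb_of_measureReal_le {Ω : ℕ → Type*} [∀ t, MeasurableSpace (Ω t)]
    {P : ∀ t, Measure (Ω t)} [∀ t, IsFiniteMeasure (P t)] {Y : ∀ t, Ω t → ℝ} {a : ℕ → ℝ}
    {n : ℕ → ℕ} {K C : ℝ} (hn : Tendsto n atTop atTop) (hK : 0 < K)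
    (h : ∀ᶠ t in atTop, (P t).real {ω | K * a t < |Y t ω|} ≤ C / n t) :
    IsBigOInProb P Y a := by
  intro δ hδ
  refine ⟨K, hK, ?_⟩
  filter_upwards [h, ((tendsto_const_div_atTop_nhds_zero_nat C).comp hn).eventually_le_const hδ]
    with t ht hCδ
  rw [← ofReal_measureReal]
  exact ENNReal.ofReal_le_ofReal (ht.trans hCδ)

theorem measureReal_le_of_ae_imp {Ω : Type*} [MeasurableSpace Ω] {P : Measure Ω}
    [IsFiniteMeasure P] {p q : Ω → Prop} (h : ∀ᵐ ω ∂P, p ω → q ω) :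
    P.real {ω | p ω} ≤ P.real {ω | q ω} :=
  ENNReal.toReal_mono (measure_ne_top _ _) (measure_mono_ae h)

/-- The number of averaged signed basis vectors per nonzero coefficient. It makes the averaging
error at most half of the curvature `a / 2` of the sample Gram matrix, see
`IsGraphLasso.l1_sub_le`. -/
noncomputable def sparsityFactor (σ a : ℝ) : ℕ := ⌈864 * σ ^ 2 / a⌉₊ + 1

/-- The lower bound for `N / (s₂ log n)`: it makes Bernstein's inequality, with deviation
`min (a / 2) (4 σ²)`, survive the union bound over all sums of `sparsityFactor σ a * s₂ + 1`
signed basis vectors. -/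
noncomputable def sampleConst (σ a : ℝ) : ℝ :=
  (2 * (sparsityFactor σ a + 1 : ℝ) + 1) * (32 * σ ^ 4) / min (a / 2) (4 * σ ^ 2) ^ 2

section Constants

variable {σ a : ℝ}

theorem lamConst_pos (hσ : 0 < σ) : 0 < lamConst σ := by
  rw [lamConst]
  positivity

theorem climeConst_pos (σ a : ℝ) : 0 < climeConst σ a := by
  rw [climeConst]
  positivity

theorem sparsityFactor_spec (ha : 0 < a) :
    72 * (2 * σ ^ 2 + 4 * σ ^ 2) ≤ a / 2 * sparsityFactor σ a := by
  have := (div_le_iff₀ ha).1 (Nat.le_ceil (864 * σ ^ 2 / a))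
  rw [sparsityFactor]
  push_cast
  linarith

theorem two_le_sampleConst (hσ : 0 < σ) (ha : 0 < a) : 2 ≤ sampleConst σ a := by
  have : 0 < min (a / 2) (4 * σ ^ 2) := by positivity
  rw [sampleConst, le_div_iff₀ (by positivity)]
  calc 2 * min (a / 2) (4 * σ ^ 2) ^ 2
    _ ≤ 2 * (4 * σ ^ 2) ^ 2 := by
        gcongr
        exact min_le_right _ _
    _ = 1 * (32 * σ ^ 4) := by ring
    _ ≤ (2 * (sparsityFactor σ a + 1 : ℝ) + 1) * (32 * σ ^ 4) := by
        gcongr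
        linarith [Nat.cast_nonneg (α := ℝ) (sparsityFactor σ a)]

theorem mul_log_le_of_sampleConst_mul_le (hσ : 0 < σ) (ha : 0 < a) {s n N : ℕ} (hs : 0 < s)
    (h : sampleConst σ a * (s * Real.log n) ≤ N) :
    (2 * ((sparsityFactor σ a * s + 1 : ℕ) : ℝ) + 1) * Real.log n ≤
      N * min (a / 2) (4 * σ ^ 2) ^ 2 / (32 * σ ^ 4) := by
  have ht : 0 < min (a / 2) (4 * σ ^ 2) := by positivity
  have hs' : (1 : ℝ) ≤ s := Nat.one_le_cast.2 hs
  have length_le : 2 * ((sparsityFactor σ a * s + 1 : ℕ) : ℝ) + 1 ≤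
      (2 * (sparsityFactor σ a + 1 : ℝ) + 1) * s := by
    push_cast
    linarith
  rw [sampleConst, div_mul_eq_mul_div, div_le_iff₀ (by positivity)] at h
  rw [le_div_iff₀ (by positivity)]
  refine le_trans ?_ h
  calc (2 * ((sparsityFactor σ a * s + 1 : ℕ) : ℝ) + 1) * Real.log n * (32 * σ ^ 4)
    _ ≤ (2 * (sparsityFactor σ a + 1 : ℝ) + 1) * s * Real.log n * (32 * σ ^ 4) := by
        have := Real.log_natCast_nonneg n
        gcongr
    _ = (2 * (sparsityFactor σ a + 1 : ℝ) + 1) * (32 * σ ^ 4) * (s * Real.log n) := by ring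

end Constants

/-! ### Probability bounds for a single regression problem -/

section SingleProblem

variable {k n N s₁ s₂ : ℕ} {G : SimpleGraph (Fin n)} [DecidableRel G.Adj] {Ω : Type*}
  [MeasurableSpace Ω] {P : Measure Ω} [IsProbabilityMeasure P]
  {X : Ω → Matrix (Fin N) (Fin n) ℝ} {ε : Ω → Fin N → ℝ} {S : Matrix (Fin n) (Fin n) ℝ}
  {βstar : Fin n → ℝ} {σ a τ ν M lam μ CLam CMu : ℝ} {β : Ω → Fin n → ℝ}
  {Θ : Ω → Matrix (Fin n) (Fin n) ℝ}

theorem isClime_of_le_or_feasible {Sg T Θ₀ : Matrix (Fin n) (Fin n) ℝ}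
    (h : (∃ Θ', ClimeFeasible Sg μ Θ') → IsClime Sg μ Θ₀) (hT : 1 ≤ μ ∨ ClimeFeasible Sg μ T) :
    IsClime Sg μ Θ₀ :=
  h (hT.elim (fun hμ => ⟨0, climeFeasible_zero Sg hμ⟩) fun hT => ⟨T, hT⟩)

theorem ClimeFeasible.vecMax_remainder_le_rate {Y : Matrix (Fin N) (Fin n) ℝ}
    {Θ₀ : Matrix (Fin n) (Fin n) ℝ} {b : Fin n → ℝ} (hΘ : ClimeFeasible (sampleGram Y) μ Θ₀)
    (hd : 2 ≤ G.maxDegree) (ha : 0 < a) (hb : l1 (b - βstar) ≤ 72 * lam * s₂ / (a / 2))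
    (hlam : lam ≤ CLam * (τ * √(Real.log n / N))) (hμ : μ ≤ CMu * √(Real.log n / N)) :
    vecMax (remainder (diffOp G k) Θ₀ Y b βstar) ≤
      144 / a * CLam * CMu * (τ * (2 * (G.maxDegree : ℝ)) ^ (((k : ℝ) + 1) / 2) *
        (s₂ * Real.log n / √N)) := by
  have hμ0 : 0 ≤ μ := (matMax_nonneg _).trans hΘ
  have hl1 := l1_nonneg (b - βstar)
  rw [rpow_natCast_add_one_div_two (by positivity)]
  set r := √((2 * (G.maxDegree : ℝ)) ^ (k + 1))
  set ρ := √(Real.log n / N) with hρ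
  calc vecMax (remainder (diffOp G k) Θ₀ Y b βstar)
    _ ≤ √N * (r * μ * l1 (b - βstar)) :=
        hΘ.vecMax_remainder_le (Real.sqrt_nonneg _) (sum_abs_diffOp_row_le G hd k) b βstar
    _ ≤ √N * (r * (CMu * ρ) * (72 * (CLam * (τ * ρ)) * s₂ / (a / 2))) := by
        have := hμ0.trans hμ
        have := hb.trans (by gcongr : _ ≤ 72 * (CLam * (τ * ρ)) * s₂ / (a / 2))
        gcongr
    _ = 144 / a * CLam * CMu * (τ * r * (s₂ * (√N * ρ ^ 2))) := by
        field_simp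
        ring
    _ = 144 / a * CLam * CMu * (τ * r * (s₂ * Real.log n / √N)) := by
        rw [hρ, sqrt_mul_sqrt_div_sq (Real.log_natCast_nonneg n) N.cast_nonneg, mul_div_assoc]

theorem IsSubGaussianDesign.measureReal_exceptional_le (hX : IsSubGaussianDesign P X σ S)
    (hσ : 0 < σ) (hN : 0 < N) (hn : 2 ≤ n) (ha : 0 < a) (hsp : spectrum ℝ S ⊆ Set.Ici a)
    (hτ : 0 < τ) (hε : HasLaw ε (Measure.pi fun _ => gaussianReal 0 (τ ^ 2).toNNReal) P)
    (hind : IndepFun X ε P) (hlam : lamConst σ * (τ * √(Real.log n / N)) ≤ lam)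
    (hμ : climeConst σ a * √(Real.log n / N) ≤ μ) {s : ℕ} (hs : 0 < s)
    (hNn : sampleConst σ a * (s * Real.log n) ≤ N) :
    P.real {ω | ¬ ((1 ≤ μ ∨ ClimeFeasible (sampleGram (X ω)) μ S⁻¹) ∧
      IsSparselyConditioned (sampleGram (X ω)) (a / 2) (2 * σ ^ 2 + 4 * σ ^ 2)
        (sparsityFactor σ a * s + 1) ∧
      ∀ j, |((X ω)ᵀ *ᵥ ε ω) j| ≤ N * (lam / 2))} ≤ 10 / n := by
  have ht : 0 < min (a / 2) (4 * σ ^ 2) := by positivity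
  have hn0 : 0 < n := by omega
  have two_mul_log_le : 2 * Real.log n ≤ N := by
    have := Real.log_natCast_nonneg n
    refine le_trans ?_ hNn
    have := two_le_sampleConst hσ ha
    gcongr
    exact le_mul_of_one_le_left ‹_› (Nat.one_le_cast.2 hs)
  have feasible := hX.measureReal_not_climeFeasible_le hσ hN hn0 ha hsp hμ
  have conditioned := hX.measureReal_not_isSparselyConditioned_le hσ hN hn hsp
    (sparsityFactor σ a * s).succ_pos ht.le (min_le_left _ _) (min_le_right _ _)
    (mul_log_le_of_sampleConst_mul_le hσ ha hs hNn)
  have noise := hX.measureReal_exists_noise_le hσ hN hn0 hτ hε hind hlam two_mul_log_le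
  simp only [not_and_or (b := _ ∧ _), not_and_or (b := ∀ _, _), not_forall, not_le,
    Set.ofPred_or]
  refine (measureReal_union_le _ _).trans ((add_le_add feasible
    ((measureReal_union_le _ _).trans (add_le_add conditioned noise))).trans_eq ?_)
  ring

theorem IsSubGaussianDesign.measureReal_vecMax_remainder_le (hX : IsSubGaussianDesign P X σ S)
    (hσ : 0 < σ) (hN : 0 < N) (hd : 2 ≤ G.maxDegree) (ha : 0 < a)
    (hsp : spectrum ℝ S ⊆ Set.Ici a) (hτ : 0 < τ)
    (hε : HasLaw ε (Measure.pi fun _ => gaussianReal 0 (τ ^ 2).toNNReal) P)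
    (hind : IndepFun X ε P) (hν : 0 ≤ ν) (hs₂ : 0 < s₂) (hβ₁ : l0 (diffOp G k *ᵥ βstar) ≤ s₁)
    (hβ₂ : l0 βstar ≤ s₂) (hs : ν * s₁ ≤ s₂)
    (hlam : lamConst σ * (τ * √(Real.log n / N)) ≤ lam ∧ lam ≤ CLam * (τ * √(Real.log n / N)))
    (hμ : climeConst σ a * √(Real.log n / N) ≤ μ ∧ μ ≤ CMu * √(Real.log n / N))
    (hβ : ∀ᵐ ω ∂P, IsGraphLasso G k (lam * √(ν / (2 * (G.maxDegree : ℝ)) ^ (k + 1))) lam (X ω)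
      (response (X ω) βstar (ε ω)) (β ω))
    (hΘ : ∀ᵐ ω ∂P, (∃ Θ', ClimeFeasible (sampleGram (X ω)) μ Θ') →
      IsClime (sampleGram (X ω)) μ (Θ ω))
    (hNn : sampleConst σ a * (s₂ * Real.log n) ≤ N) :
    P.real {ω | 144 / a * CLam * CMu * (τ * (2 * (G.maxDegree : ℝ)) ^ (((k : ℝ) + 1) / 2) *
      (s₂ * Real.log n / √N)) < |vecMax (remainder (diffOp G k) (Θ ω) (X ω) (β ω) βstar)|} ≤
      10 / n := by
  have hn : 2 ≤ n := one_lt_of_maxDegree_pos (two_pos.trans_le hd)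
  have hlam0 : 0 < lam :=
    (mul_pos (lamConst_pos hσ) (mul_pos hτ (sqrt_log_div_pos hn hN))).trans_le hlam.1
  refine (measureReal_le_of_ae_imp ?_).trans
    (hX.measureReal_exceptional_le hσ hN hn ha hsp hτ hε hind hlam.1 hμ.1 hs₂ hNn)
  filter_upwards [hβ, hΘ] with ω hβω hΘω
  contrapose!
  rintro ⟨feasible, conditioned, noise⟩
  rw [abs_of_nonneg (vecMax_nonneg _)]
  refine (isClime_of_le_or_feasible hΘω feasible).1.vecMax_remainder_le_rate hd ha ?_ hlam.2 hμ.2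
  exact hβω.l1_sub_le hN (two_pos.trans_le hd) hlam0 hν hs₂ hβ₁ hβ₂ hs noise (by positivity)
    (by positivity) (Nat.succ_pos _) (sparsityFactor_spec ha) conditioned

theorem IsSubGaussianDesign.measureReal_matMax_sandwich_sub_le
    (hX : IsSubGaussianDesign P X σ S) (hσ : 0 < σ) (hN : 0 < N) (hd : 2 ≤ G.maxDegree)
    (ha : 0 < a) (hsp : spectrum ℝ S ⊆ Set.Ici a) (hM : opInf S⁻¹ ≤ M)
    (hμ : climeConst σ a * √(Real.log n / N) ≤ μ ∧ μ ≤ CMu * √(Real.log n / N))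
    (hΘ : ∀ᵐ ω ∂P, (∃ Θ', ClimeFeasible (sampleGram (X ω)) μ Θ') →
      IsClime (sampleGram (X ω)) μ (Θ ω)) :
    P.real {ω | 3 * CMu * ((2 * (G.maxDegree : ℝ)) ^ (k + 1) * M * √(Real.log n / N)) <
      |matMax (sandwich (diffOp G k) (Θ ω) (X ω) - diffOp G k * S⁻¹ * (diffOp G k)ᵀ)|} ≤
      4 / n := by
  have hn : 0 < n := one_pos.trans (one_lt_of_maxDegree_pos (two_pos.trans_le hd))
  have inv_isSymm : S⁻¹.IsSymm := by rw [IsSymm, transpose_nonsing_inv, hX.isSymm_cov hN]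
  refine (measureReal_le_of_ae_imp ?_).trans
    (hX.measureReal_not_climeFeasible_le hσ hN hn ha hsp hμ.1)
  filter_upwards [hΘ] with ω hΘω
  contrapose!
  intro feasible
  rw [abs_of_nonneg (matMax_nonneg _)]
  calc matMax (sandwich (diffOp G k) (Θ ω) (X ω) - diffOp G k * S⁻¹ * (diffOp G k)ᵀ)
    _ ≤ √((2 * (G.maxDegree : ℝ)) ^ (k + 1)) ^ 2 * (3 * (M * μ)) :=
        (isClime_of_le_or_feasible hΘω feasible).matMax_sandwich_sub_le (Real.sqrt_nonneg _)
          (sum_abs_diffOp_row_le G hd k) inv_isSymm hM feasible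
    _ ≤ (2 * (G.maxDegree : ℝ)) ^ (k + 1) * (3 * (M * (CMu * √(Real.log n / N)))) := by
        have := (opInf_nonneg _).trans hM
        rw [Real.sq_sqrt (by positivity)]
        gcongr
        exact hμ.2
    _ = 3 * CMu * ((2 * (G.maxDegree : ℝ)) ^ (k + 1) * M * √(Real.log n / N)) := by ring

end SingleProblem

end GPPL

theorem corollary1_general (σx cmin : ℝ) (hσx : 0 < σx) (hcmin : 0 < cmin) :
    ∃ cLam cMu κ : ℝ, 0 < cLam ∧ 0 < cMu ∧ 0 < κ ∧
    ∀ (k : ℕ → ℕ) (ν : ℕ → ℝ) (CLam CMu : ℝ)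
      (n N s₁ s₂ : ℕ → ℕ) (G : ∀ t, SimpleGraph (Fin (n t))) [∀ t, DecidableRel (G t).Adj]
      (Ω : ℕ → Type*) [∀ t, MeasurableSpace (Ω t)]
      (P : ∀ t, Measure (Ω t)) [∀ t, IsProbabilityMeasure (P t)]
      (X : ∀ t, Ω t → Matrix (Fin (N t)) (Fin (n t)) ℝ) (ε : ∀ t, Ω t → Fin (N t) → ℝ)
      (S : ∀ t, Matrix (Fin (n t)) (Fin (n t)) ℝ) (βstar : ∀ t, Fin (n t) → ℝ)
      (σε M lam lamG μ : ℕ → ℝ)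
      (βhat : ∀ t, Ω t → Fin (n t) → ℝ)
      (Θhat : ∀ t, Matrix (Fin (N t)) (Fin (n t)) ℝ → Matrix (Fin (n t)) (Fin (n t)) ℝ),
      (∀ t, 0 ≤ ν t) →
      Tendsto n atTop atTop →
      (∀ t, 0 < N t) →
      (∀ t, 2 ≤ (G t).maxDegree) →
      (∀ t, 0 < s₁ t ∧ 0 < s₂ t) →
      (∀ t, l0 (diffOp (G t) (k t) *ᵥ βstar t) ≤ s₁ t ∧ l0 (βstar t) ≤ s₂ t) →
      (∀ t, ν t ≤ (s₂ t : ℝ) / s₁ t) →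
      (∀ t, IsSubGaussianDesign (P t) (X t) σx (S t)) →
      (∀ t, spectrum ℝ (S t) ⊆ Set.Ici cmin) →
      (∀ t, opInf (S t)⁻¹ ≤ M t) →
      (∀ t, 0 < σε t) →
      (∀ t, HasLaw (ε t) (Measure.pi fun _ => gaussianReal 0 (σε t ^ 2).toNNReal) (P t)) →
      (∀ t, IndepFun (X t) (ε t) (P t)) →
      (∀ t, cLam * (σε t * √(Real.log (n t) / N t)) ≤ lam t ∧
        lam t ≤ CLam * (σε t * √(Real.log (n t) / N t))) →
      (∀ t, lamG t = lam t * √(ν t / (2 * ((G t).maxDegree : ℝ)) ^ (k t + 1))) →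
      (∀ t, cMu * √(Real.log (n t) / N t) ≤ μ t ∧ μ t ≤ CMu * √(Real.log (n t) / N t)) →
      (∀ t, ∀ᵐ ω ∂(P t), IsGraphLasso (G t) (k t) (lamG t) (lam t) (X t ω)
        (response (X t ω) (βstar t) (ε t ω)) (βhat t ω)) →
      (∀ t, Measurable (Θhat t)) →
      (∀ t, ∀ᵐ ω ∂(P t), (∃ Θ, ClimeFeasible (sampleGram (X t ω)) (μ t) Θ) →
        IsClime (sampleGram (X t ω)) (μ t) (Θhat t (X t ω))) →
      (∀ t ω, √(N t : ℝ) • (diffOp (G t) (k t) *ᵥ oneStep (Θhat t (X t ω)) (X t ω)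
            (response (X t ω) (βstar t) (ε t ω)) (βhat t ω) - diffOp (G t) (k t) *ᵥ βstar t) =
          noiseTerm (diffOp (G t) (k t)) (Θhat t (X t ω)) (X t ω) (ε t ω) -
            remainder (diffOp (G t) (k t)) (Θhat t (X t ω)) (X t ω) (βhat t ω) (βstar t)) ∧
      (∀ t, ∀ᵐ x ∂((P t).map (X t)),
        condDistrib (fun ω => WithLp.toLp 2
            (noiseTerm (diffOp (G t) (k t)) (Θhat t (X t ω)) (X t ω) (ε t ω))) (X t) (P t) x =
          multivariateGaussian 0 (σε t ^ 2 • sandwich (diffOp (G t) (k t)) (Θhat t x) x)) ∧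
      ((∀ᶠ t in atTop, κ * (s₂ t * Real.log (n t)) ≤ N t) →
        IsBigOInProb P
          (fun t ω => vecMax
            (remainder (diffOp (G t) (k t)) (Θhat t (X t ω)) (X t ω) (βhat t ω) (βstar t)))
          (fun t => σε t * (2 * ((G t).maxDegree : ℝ)) ^ (((k t : ℝ) + 1) / 2) *
            (s₂ t * Real.log (n t) / √(N t : ℝ)))) ∧
      IsBigOInProb P
        (fun t ω => matMax (sandwich (diffOp (G t) (k t)) (Θhat t (X t ω)) (X t ω) -
          diffOp (G t) (k t) * (S t)⁻¹ * (diffOp (G t) (k t))ᵀ))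
        (fun t => (2 * ((G t).maxDegree : ℝ)) ^ (k t + 1) * M t *
          √(Real.log (n t) / N t)) := by
  refine ⟨lamConst σx, climeConst σx cmin, sampleConst σx cmin, lamConst_pos hσx,
    climeConst_pos σx cmin, two_pos.trans_le (two_le_sampleConst hσx hcmin), ?_⟩
  intro k ν CLam CMu n N s₁ s₂ G _ Ω _ P _ X ε S βstar σε M lam lamG μ βhat Θhat hν hn hN hd hs0 hl0
    hs hX hsp hM hσε hε hind hlam hlamG hμ hβ hΘm hΘ
  obtain rfl := funext hlamG
  have hρ := sqrt_log_div_pos (one_lt_of_maxDegree_pos (two_pos.trans_le (hd 0))) (hN 0)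
  have hCLam : 0 < CLam := (lamConst_pos hσx).trans_le
    (le_of_mul_le_mul_right ((hlam 0).1.trans (hlam 0).2) (mul_pos (hσε 0) hρ))
  have hCMu : 0 < CMu := (climeConst_pos σx cmin).trans_le
    (le_of_mul_le_mul_right ((hμ 0).1.trans (hμ 0).2) hρ)
  refine ⟨fun t ω => sqrt_smul_mulVec_oneStep_sub (hN t) _ _ _ _ _ _,
    fun t => condDistrib_noiseTerm (hX t).measurable (hε t) (hind t) _ (hΘm t), fun hκ => ?_, ?_⟩
  · refine isBigOInProb_of_measureReal_le hn (K := 144 / cmin * CLam * CMu) (C := 10)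
      (by positivity) (hκ.mono fun t ht => ?_)
    exact (hX t).measureReal_vecMax_remainder_le hσx (hN t) (hd t) hcmin (hsp t) (hσε t) (hε t)
      (hind t) (hν t) (hs0 t).2 (hl0 t).1 (hl0 t).2
      ((le_div_iff₀ (Nat.cast_pos.2 (hs0 t).1)).1 (hs t)) (hlam t) (hμ t) (hβ t) (hΘ t) ht
  · exact isBigOInProb_of_measureReal_le hn (K := 3 * CMu) (C := 4) (by positivity)
      (.of_forall fun t => (hX t).measureReal_matMax_sandwich_sub_le hσx (hN t) (hd t) hcmin
        (hsp t) (hM t) (hμ t) (hΘ t))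

theorem corollary1 (σx cmin cmax ν : ℝ) (hσx : 0 < σx) (hcmin : 0 < cmin)
    (hν : 0 ≤ ν) (hν1 : ν < 1) :
    -- thresholds for the tuning constants and the sample size
    ∃ cLam cMu κ : ℝ, 0 < cLam ∧ 0 < cMu ∧ 0 < κ ∧
    ∀ (k : ℕ) (CLam CMu : ℝ)
      -- a sequence of regression problems: `N t` observations, a graph with `n t` nodes
      (n N s₁ s₂ : ℕ → ℕ) (G : ∀ t, SimpleGraph (Fin (n t))) [∀ t, DecidableRel (G t).Adj]
      (Ω : ℕ → Type*) [∀ t, MeasurableSpace (Ω t)]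
      (P : ∀ t, Measure (Ω t)) [∀ t, IsProbabilityMeasure (P t)]
      (X : ∀ t, Ω t → Matrix (Fin (N t)) (Fin (n t)) ℝ) (ε : ∀ t, Ω t → Fin (N t) → ℝ)
      (S : ∀ t, Matrix (Fin (n t)) (Fin (n t)) ℝ) (βstar : ∀ t, Fin (n t) → ℝ)
      (σε M lam lamG μ : ℕ → ℝ)
      (βhat : ∀ t, Ω t → Fin (n t) → ℝ)
      (Θhat : ∀ t, Matrix (Fin (N t)) (Fin (n t)) ℝ → Matrix (Fin (n t)) (Fin (n t)) ℝ),
      Tendsto n atTop atTop →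
      (∀ t, 0 < N t) →
      -- the maximum degree is at least two
      (∀ t, 2 ≤ (G t).maxDegree) →
      -- the true coefficients are simultaneously piecewise polynomial and sparse
      (∀ t, 0 < s₁ t ∧ 0 < s₂ t) →
      (∀ t, l0 (diffOp (G t) k *ᵥ βstar t) ≤ s₁ t ∧ l0 (βstar t) ≤ s₂ t) →
      (∀ t, ν ≤ (s₂ t : ℝ) / s₁ t) →
      -- sub-Gaussian design with bounded eigenvalues of the covariance matrix
      (∀ t, IsSubGaussianDesign (P t) (X t) σx (S t)) →
      (∀ t, spectrum ℝ (S t) ⊆ Set.Icc cmin cmax) →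
      (∀ t, opInf (S t)⁻¹ ≤ M t) →
      -- Gaussian noise, independent of the design
      (∀ t, 0 < σε t) →
      (∀ t, HasLaw (ε t) (Measure.pi fun _ => gaussianReal 0 (σε t ^ 2).toNNReal) (P t)) →
      (∀ t, IndepFun (X t) (ε t) (P t)) →
      -- tuning parameters
      (∀ t, cLam * (σε t * √(Real.log (n t) / N t)) ≤ lam t ∧
        lam t ≤ CLam * (σε t * √(Real.log (n t) / N t))) →
      (∀ t, lamG t = lam t * √(ν / (2 * ((G t).maxDegree : ℝ)) ^ (k + 1))) →
      (∀ t, cMu * √(Real.log (n t) / N t) ≤ μ t ∧ μ t ≤ CMu * √(Real.log (n t) / N t)) →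
      -- the initial estimator
      (∀ t, ∀ᵐ ω ∂(P t), IsGraphLasso (G t) k (lamG t) (lam t) (X t ω)
        (response (X t ω) (βstar t) (ε t ω)) (βhat t ω)) →
      -- the CLIME estimator, a measurable function of the design that solves the program
      -- whenever the program is feasible
      (∀ t, Measurable (Θhat t)) →
      (∀ t, ∀ᵐ ω ∂(P t), (∃ Θ, ClimeFeasible (sampleGram (X t ω)) (μ t) Θ) →
        IsClime (sampleGram (X t ω)) (μ t) (Θhat t (X t ω))) →
      -- the decomposition
      (∀ t ω, √(N t : ℝ) • (diffOp (G t) k *ᵥ oneStep (Θhat t (X t ω)) (X t ω)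
            (response (X t ω) (βstar t) (ε t ω)) (βhat t ω) - diffOp (G t) k *ᵥ βstar t) =
          noiseTerm (diffOp (G t) k) (Θhat t (X t ω)) (X t ω) (ε t ω) -
            remainder (diffOp (G t) k) (Θhat t (X t ω)) (X t ω) (βhat t ω) (βstar t)) ∧
      -- the conditional law of the noise term given the design
      (∀ t, ∀ᵐ x ∂((P t).map (X t)),
        condDistrib (fun ω => WithLp.toLp 2
            (noiseTerm (diffOp (G t) k) (Θhat t (X t ω)) (X t ω) (ε t ω))) (X t) (P t) x =
          multivariateGaussian 0 (σε t ^ 2 • sandwich (diffOp (G t) k) (Θhat t x) x)) ∧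
      -- the size of the remainder
      ((∀ᶠ t in atTop, κ * (s₂ t * Real.log (n t)) ≤ N t) →
        IsBigOInProb P
          (fun t ω => vecMax
            (remainder (diffOp (G t) k) (Θhat t (X t ω)) (X t ω) (βhat t ω) (βstar t)))
          (fun t => σε t * (2 * ((G t).maxDegree : ℝ)) ^ (((k : ℝ) + 1) / 2) *
            (s₂ t * Real.log (n t) / √(N t : ℝ)))) ∧
      -- the sandwich covariance
      IsBigOInProb P
        (fun t ω => matMax (sandwich (diffOp (G t) k) (Θhat t (X t ω)) (X t ω) -
          diffOp (G t) k * (S t)⁻¹ * (diffOp (G t) k)ᵀ))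
        (fun t => (2 * ((G t).maxDegree : ℝ)) ^ (k + 1) * M t *
          √(Real.log (n t) / N t)) := by
  obtain ⟨cLam, cMu, κ, hcLam, hcMu, hκ, h⟩ := corollary1_general σx cmin hσx hcmin
  exact ⟨cLam, cMu, κ, hcLam, hcMu, hκ, fun k CLam CMu n N s₁ s₂ G _ Ω _ P _ X ε S βstar σε M lam
    lamG μ βhat Θhat hn hN hd hs0 hl0 hs hX hsp => h (fun _ => k) (fun _ => ν) CLam CMu n N s₁ s₂ G
    Ω P X ε S βstar σε M lam lamG μ βhat Θhat (fun _ => hν) hn hN hd hs0 hl0 hs hX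
    fun t => (hsp t).trans Set.Icc_subset_Ici_self⟩
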